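/- Let $M$ be a connected topological manifold (Hausdorff, paracompact, locally homeomorphic to $\mathbb{R}^n$), $x\in M$, and let $\pi\colon\tilde M\to M$ be the universal covering, i.e. a covering map with $\tilde M$ simply connected. Let $I=[0,1]$, let $\mathscr{L}(M,x)$ be the space of loops $\gamma\in C(I,M)$ with $\gamma(0)=\gamma(1)=x$, let $\mathrm{Aut}_\pi(\tilde M)$ be the group of homeomorphisms $\varphi$ of $\tilde M$ with $\pi\circ\varphi=\pi$, and for $\varphi\in\mathrm{Aut}_\pi(\tilde M)$ and $e\in\tilde M$ put $$\mathscr{L}_\varphi(\tilde M,e)=\{\gamma\in C(I,\tilde M):\gamma(0)=e,\ \gamma(1)=\varphi(e)\}.$$ Path spaces carry the compact-open topology, disjoint unions the disjoint union topology, and $\mathrm{Aut}_\pi(\tilde M)$ the discrete topology. For $\gamma\in\mathscr{L}(M,x)$ and $e\in\pi^{-1}(x)$ let $\tilde\gamma_e$ be the lift of $\gamma$ with $\tilde\gamma_e(0)=e$. The path components of $\mathscr{L}(M,x)$ are the homotopy classes (rel endpoints) of loops; write $U_\eta$ for the component of $\eta$. For all $e,e'\in\pi^{-1}(x)$ there is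 exactly one $\psi\in\mathrm{Aut}_\pi(\tilde M)$ with $\psi(e)=e'$. (a) Let $\eta\in\mathscr{L}(M,x)$ and $e,e'\in\pi^{-1}(x)$, let $\varphi\in\mathrm{Aut}_\pi(\tilde M)$ be such that $\varphi(e)=\tilde\eta_e(1)$, and $\psi\in\mathrm{Aut}_\pi(\tilde M)$ such that $\psi(e)=e'$. Then $\Psi_e(\gamma)=\tilde\gamma_e$, $\Psi_{e'}(\gamma)=\tilde\gamma_{e'}$ and $L_\psi(\gamma)=\psi\circ\gamma$ define homeomorphisms $$\Psi_e\colon U_\eta\to\mathscr{L}_\varphi(\tilde M,e),\quad \Psi_{e'}\colon U_\eta\to\mathscr{L}_{\psi\varphi\psi^{-1}}(\tilde M,e'),\quad L_\psi\colon\mathscr{L}_\varphi(\tilde M,e)\to\mathscr{L}_{\psi\varphi\psi^{-1}}(\tilde M,e'),$$ and $L_\psi\circ\Psi_e=\Psi_{e'}$. Moreover, if $c_x$ is the constant loop at $x$, then for all $e\in\pi^{-1}(x)$ and $\varphi\in\mathrm{Aut}_\pi(\tilde M)$ the assignment $\gamma\mapsto\tilde\gamma_e$ defines a homeomorphism $U_{c_x}\to\mathscr{L}_\varphi(\tilde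 M,e)$ if and only if $\varphi=\mathrm{id}_{\tilde M}$. (b) For every $e\in\pi^{-1}(x)$ there is a group isomorphism $\Phi_e\colon\pi_1(M,x)\to\mathrm{Aut}_\pi(\tilde M)$ with $\Phi_e([\gamma])(e)=\tilde\gamma_e(1)$ for all $\gamma\in\mathscr{L}(M,x)$, where the product in $\pi_1(M,x)$ is concatenation. If $e,e'\in\pi^{-1}(x)$ and $\psi\in\mathrm{Aut}_\pi(\tilde M)$ satisfies $\psi(e)=e'$, then $C_\psi\circ\Phi_e=\Phi_{e'}$, where $C_\psi(\varphi)=\psi\varphi\psi^{-1}$. (c) Let $E=\coprod_{\varphi\in\mathrm{Aut}_\pi(\tilde M),\,e\in\pi^{-1}(x)}\mathscr{L}_\varphi(\tilde M,e)$. The map $\tilde\pi_x\colon E\to\mathscr{L}(M,x)$, $\tilde\pi_x(\gamma)=\pi\circ\gamma$, is a covering map each of whose fibres has the cardinality of $\pi_1(M,x)$. It restricts to a surjective covering map $\coprod_{e\in\pi^{-1}(x)}\mathscr{L}_{\mathrm{id}}(\tilde M,e)\to U_{c_x}$. With the right action $\gamma\cdot\xi=\xi^{-1}\circ\gamma$ the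 map $\tilde\pi_x$ is a principal $\mathrm{Aut}_\pi(\tilde M)$-bundle. Suppose in addition that $M$ carries a smooth structure. Then $\tilde M$ has a smooth structure for which $\pi$ is a local diffeomorphism, and $\mathscr{L}(M,x)$ and all $\mathscr{L}_\varphi(\tilde M,e)$ with $e\in\pi^{-1}(x)$ are smooth Banach manifolds modelled on $\{\eta\in C(I,\mathbb{R}^n):\eta(0)=\eta(1)=0\}$, their atlas consisting of the standard charts $\gamma\mapsto(t\mapsto\Phi_t^{-1}(\gamma(t)))$. Here $(\Phi_t)_{t\in I}$ is any family of diffeomorphisms from open subsets of $\mathbb{R}^n$ onto open subsets of the manifold, with $\bigcup_t\{t\}\times\mathrm{dom}\,\Phi_t$ and $\bigcup_t\{t\}\times\mathrm{im}\,\Phi_t$ open, such that $\Phi_t$, $\Phi_t^{-1}$ and, in charts, all their derivatives in the non-$t$ variables are jointly continuous, and such that $\Phi_0(0)$ and $\Phi_1(0)$ are the prescribed endpoints of the paths. Furthermore $E$ is a smooth Banach manifold for which all inclusions $\mathscr{L}_\varphi(\tilde M,e)\to E$ are local diffeomorphisms, and $\tilde\pi_x$ is a smooth principal bundle of Banach manifolds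 whose structure group $\mathrm{Aut}_\pi(\tilde M)$ is a Lie group of dimension $0$: projection and action are smooth, and there are equivariant local trivialisations that are diffeomorphisms. -/

import Mathlib

open Set Topology unitInterval
open scoped Manifold ContDiff

namespace TwistedLoops

noncomputable section

/-! ### Deck transformations, twisted loops and lifts -/

/-- The group `Aut_π(M̃)` of deck transformations of `π : M̃ → M`; multiplication is composition. -/
def deckGroup {X Y : Type*} [TopologicalSpace X] (π : X → Y) : Subgroup (X ≃ₜ X) where
  carrier := {φ | ∀ z, π (φ z) = π z}
  one_mem' _ := rfl
  mul_mem' {φ ψ} hφ hψ z := (hφ (ψ z)).trans (hψ z)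
  inv_mem' {φ} hφ z := by
    have h := hφ (φ⁻¹ z)
    rw [show φ (φ⁻¹ z) = z from φ.apply_symm_apply z] at h
    exact h.symm

/-- The deck transformation group carries the discrete topology. -/
instance deckTopology {X Y : Type*} [TopologicalSpace X] (π : X → Y) :
    TopologicalSpace (deckGroup π) := ⊥

instance deckDiscrete {X Y : Type*} [TopologicalSpace X] (π : X → Y) :
    DiscreteTopology (deckGroup π) := ⟨rfl⟩

/-- The based twisted loop space `ℒ_φ(M̃, e)`: continuous paths `γ : [0,1] → M̃` with `γ 0 = e` and
`γ 1 = φ e`, with the compact-open topology (the topology of uniform convergence). -/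
abbrev TwistedLoopSpace {X Y : Type*} [TopologicalSpace X] {π : X → Y}
    (φ : deckGroup π) (e : X) : Type _ := Path e (φ.1 e)

/-- The lift `γ̃_e` of a loop `γ` at `x`, starting at a point `e` of the fibre over `x`. -/
def liftAt {X Y : Type*} [TopologicalSpace X] [TopologicalSpace Y] {π : X → Y}
    (hπ : IsCoveringMap π) {x : Y} (γ : Path x x) (e : π ⁻¹' {x}) : C(I, X) :=
  hπ.liftPath γ e.1 (γ.source.trans (show π e.1 = x from e.2).symm)

/-- The disjoint union of all `ℒ_φ(M̃, e)`, over deck transformations `φ` and points `e` of the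
fibre over `x`, with the disjoint union topology. -/
abbrev TotalSpace {X Y : Type*} [TopologicalSpace X] (π : X → Y) (x : Y) : Type _ :=
  Σ p : deckGroup π × (π ⁻¹' {x}), TwistedLoopSpace p.1 p.2.1

/-- The projection `γ ↦ π ∘ γ` from the disjoint union of the twisted loop spaces to the based
loop space `ℒ(M, x) = Path x x`. -/
def totalProj {X Y : Type*} [TopologicalSpace X] [TopologicalSpace Y] {π : X → Y}
    (hπ : Continuous π) {x : Y} (z : TotalSpace π x) : Path x x :=
  (z.2.map hπ).cast (show π z.1.2.1 = x from z.1.2.2).symm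
    ((z.1.1.2 z.1.2.1).trans (show π z.1.2.1 = x from z.1.2.2)).symm

/-- The right action `γ · ξ = ξ⁻¹ ∘ γ` of the deck transformation group on the disjoint union of the
twisted loop spaces. It sends `ℒ_φ(M̃, e)` to `ℒ_{ξ⁻¹ φ ξ}(M̃, ξ⁻¹ e)`. -/
def totalAct {X Y : Type*} [TopologicalSpace X] {π : X → Y} {x : Y}
    (z : TotalSpace π x) (ξ : deckGroup π) : TotalSpace π x :=
  ⟨(ξ⁻¹ * z.1.1 * ξ, ⟨ξ⁻¹.1 z.1.2.1, (ξ⁻¹.2 z.1.2.1).trans z.1.2.2⟩),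
    (z.2.map ξ⁻¹.1.continuous).cast rfl
      (show ξ⁻¹.1 (z.1.1.1 (ξ.1 (ξ.1.symm z.1.2.1))) = ξ⁻¹.1 (z.1.1.1 z.1.2.1) by
        rw [Homeomorph.apply_symm_apply])⟩

/-! ### Principal bundles -/

/-- `p : P → B` is a (topological) principal `G`-bundle with respect to the right action `act`. -/
structure IsPrincipalBundle {G P B : Type*} [Group G] [TopologicalSpace G] [TopologicalSpace P]
    [TopologicalSpace B] (p : P → B) (act : P → G → P) : Prop where
  isTopologicalGroup : IsTopologicalGroup G
  act_one : ∀ z, act z 1 = z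
  act_mul : ∀ z g h, act z (g * h) = act (act z g) h
  proj_act : ∀ z g, p (act z g) = p z
  continuous_act : Continuous fun q : P × G => act q.1 q.2
  exists_trivialization : ∀ b, ∃ t : Bundle.Trivialization G p, b ∈ t.baseSet ∧
    ∀ z, p z ∈ t.baseSet → ∀ g, (t (act z g)).2 = (t z).2 * g

/-- `p : P → B` is a smooth principal `G`-bundle of Banach manifolds with respect to the right
action `act`: the group is a Lie group, all spaces are smooth manifolds modelled on the Banach
spaces `EG`, `EP`, `EB`, the projection and the action are smooth, and there are equivariant local
trivialisations which are diffeomorphisms. -/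
structure IsSmoothPrincipalBundle (EG EP EB : Type*)
    [NormedAddCommGroup EG] [NormedSpace ℝ EG] [CompleteSpace EG]
    [NormedAddCommGroup EP] [NormedSpace ℝ EP] [CompleteSpace EP]
    [NormedAddCommGroup EB] [NormedSpace ℝ EB] [CompleteSpace EB]
    {G P B : Type*} [Group G] [TopologicalSpace G] [ChartedSpace EG G]
    [TopologicalSpace P] [ChartedSpace EP P] [TopologicalSpace B] [ChartedSpace EB B]
    (p : P → B) (act : P → G → P) : Prop where
  lieGroup : LieGroup 𝓘(ℝ, EG) ∞ G
  isManifold_total : IsManifold 𝓘(ℝ, EP) ∞ P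
  isManifold_base : IsManifold 𝓘(ℝ, EB) ∞ B
  act_one : ∀ z, act z 1 = z
  act_mul : ∀ z g h, act z (g * h) = act (act z g) h
  proj_act : ∀ z g, p (act z g) = p z
  contMDiff_proj : ContMDiff 𝓘(ℝ, EP) 𝓘(ℝ, EB) ∞ p
  contMDiff_act : ContMDiff (𝓘(ℝ, EP).prod 𝓘(ℝ, EG)) 𝓘(ℝ, EP) ∞ fun q : P × G => act q.1 q.2
  exists_trivialization : ∀ b, ∃ t : Bundle.Trivialization G p, b ∈ t.baseSet ∧
    (∀ z, p z ∈ t.baseSet → ∀ g, (t (act z g)).2 = (t z).2 * g) ∧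
    ContMDiffOn 𝓘(ℝ, EP) (𝓘(ℝ, EB).prod 𝓘(ℝ, EG)) ∞ t t.source ∧
    ContMDiffOn (𝓘(ℝ, EB).prod 𝓘(ℝ, EG)) 𝓘(ℝ, EP) ∞ t.toOpenPartialHomeomorph.symm t.target

/-- The discrete group of deck transformations as a zero-dimensional manifold. -/
instance deckCharts {X Y : Type*} [TopologicalSpace X] (π : X → Y) :
    ChartedSpace PUnit.{1} (deckGroup π) :=
  ChartedSpace.ofDiscreteTopology

/-! ### The Banach manifold structure on spaces of continuous paths -/

/-- The space of continuous paths in `V` vanishing at both endpoints, with the supremum norm. -/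
def pathModel (V : Type*) [NormedAddCommGroup V] [NormedSpace ℝ V] : Submodule ℝ C(I, V) where
  carrier := {η | η 0 = 0 ∧ η 1 = 0}
  zero_mem' := ⟨rfl, rfl⟩
  add_mem' {a b} ha hb := by
    constructor
    · simp [ha.1, hb.1]
    · simp [ha.2, hb.2]
  smul_mem' c a ha := by
    constructor
    · simp [ha.1]
    · simp [ha.2]

instance pathModelComplete (V : Type*) [NormedAddCommGroup V] [NormedSpace ℝ V] [CompleteSpace V] :
    CompleteSpace (pathModel V) := by
  have h : IsClosed (pathModel V : Set C(I, V)) :=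
    (isClosed_eq (continuous_eval_const (0 : I)) continuous_const).inter
      (isClosed_eq (continuous_eval_const (1 : I)) continuous_const)
  exact h.completeSpace_coe

/-- A family `Φ t`, `t ∈ [0,1]`, of parametrisations of open subsets of the smooth manifold `N` by
open subsets of `V`, which depends continuously on `t` and is smooth on each slice, all derivatives
of `Φ t` and of its inverse in the direction of the slice being jointly continuous. A typical
example is `Φ t v = exp (A t v)`, where `A t : V ≃ T_{γ t} N` is a continuous trivialisation of the
pullback of the tangent bundle along a path `γ`. -/
structure IsSmoothFamily {V N : Type*} [NormedAddCommGroup V] [NormedSpace ℝ V]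
    [TopologicalSpace N] [ChartedSpace V N] (Φ : I → OpenPartialHomeomorph V N) : Prop where
  isOpen_source : IsOpen {q : I × V | q.2 ∈ (Φ q.1).source}
  isOpen_target : IsOpen {q : I × N | q.2 ∈ (Φ q.1).target}
  continuousOn : ContinuousOn (fun q : I × V => Φ q.1 q.2) {q | q.2 ∈ (Φ q.1).source}
  continuousOn_symm : ContinuousOn (fun q : I × N => (Φ q.1).symm q.2) {q | q.2 ∈ (Φ q.1).target}
  contDiffOn : ∀ κ ∈ atlas V N, ∀ t,
    ContDiffOn ℝ ∞ (fun v => κ (Φ t v)) {v | v ∈ (Φ t).source ∧ Φ t v ∈ κ.source}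
  contDiffOn_symm : ∀ κ ∈ atlas V N, ∀ t,
    ContDiffOn ℝ ∞ (fun v => (Φ t).symm (κ.symm v)) {v | v ∈ κ.target ∧ κ.symm v ∈ (Φ t).target}
  continuousOn_deriv : ∀ κ ∈ atlas V N, ∀ k : ℕ,
    ContinuousOn (fun q : I × V => iteratedFDeriv ℝ k (fun v => κ (Φ q.1 v)) q.2)
      {q | q.2 ∈ (Φ q.1).source ∧ Φ q.1 q.2 ∈ κ.source}
  continuousOn_deriv_symm : ∀ κ ∈ atlas V N, ∀ k : ℕ,
    ContinuousOn (fun q : I × V => iteratedFDeriv ℝ k (fun v => (Φ q.1).symm (κ.symm v)) q.2)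
      {q | q.2 ∈ κ.target ∧ κ.symm q.2 ∈ (Φ q.1).target}

/-- The standard charts of the space of continuous paths from `y` to `z` in a smooth manifold `N`:
given a smooth family `Φ` with `Φ 0 0 = y` and `Φ 1 0 = z`, a path `γ` with values in the images of
the `Φ t` is sent to the path `t ↦ (Φ t)⁻¹ (γ t)` in `V`, which vanishes at both endpoints. -/
def IsStandardPathChart {V N : Type*} [NormedAddCommGroup V] [NormedSpace ℝ V]
    [TopologicalSpace N] [ChartedSpace V N] {y z : N}
    (c : OpenPartialHomeomorph (Path y z) (pathModel V)) : Prop :=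
  ∃ Φ : I → OpenPartialHomeomorph V N, IsSmoothFamily Φ ∧
    (0 ∈ (Φ 0).source ∧ Φ 0 0 = y) ∧ (0 ∈ (Φ 1).source ∧ Φ 1 0 = z) ∧
    c.source = {γ | ∀ t, γ t ∈ (Φ t).target} ∧
    c.target = {η | ∀ t, η.1 t ∈ (Φ t).source} ∧
    ∀ γ ∈ c.source, ∀ t, (c γ).1 t = (Φ t).symm (γ t)

/-- The given charts on the space of continuous paths from `y` to `z` in the smooth manifold `N` are
precisely the standard ones, and they make it a smooth (Banach) manifold. -/
structure IsStandardPathManifold {V N : Type*} [NormedAddCommGroup V] [NormedSpace ℝ V]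
    [TopologicalSpace N] [ChartedSpace V N] (y z : N) [ChartedSpace (pathModel V) (Path y z)] :
    Prop where
  atlas_eq : atlas (pathModel V) (Path y z) = {c | IsStandardPathChart c}
  isManifold : IsManifold 𝓘(ℝ, pathModel V) ∞ (Path y z)

end

end TwistedLoops

/-! Topology. The lift `liftAt` of a loop depends continuously on the loop, so its end point `endAt`
is a continuous map into the discrete fibre. Because the covering space is simply connected, two
loops have the same lifted end point exactly when they are homotopic (`endAt_eq_iff_homotopic`).
Hence each path component of the loop space is an open level set of `endAt`, and lifting and
projecting are mutually inverse homeomorphisms between it and a twisted loop space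
(`liftHomeomorph`).

Deck transformations act simply transitively on the fibre by the lifting criterion
(`existsUnique_deck`). Comparing this action with monodromy, which commutes with it, gives the
isomorphism with the fundamental group. An element of the total space is determined by its
projection and its starting point, and the choice of `e₀` turns the starting point into a group
element. So the bundle is even globally trivial (`bijective_totalProj_fibreCoord`,
`totalTrivialization`).

Smoothness. If `f` is smooth along slices with jointly continuous derivatives, then `η ↦ f (t, η t)`
is smooth for the supremum norm (`contDiffOn_superposition`), and transitions between standard
charts are of this type. Every path is the centre of some smooth family, built over a subdivision of
`I` by translating in one chart at a time (`exists_isFamilyAlong`). A local diffeomorphism carries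
small families to families, so pushing paths forward is the identity in suitable charts
(`isLocalDiffeomorph_pushPath`). The total space receives the structure pulled back along its
projection, and smoothness of maps into it is tested after projecting. -/

namespace TwistedLoops

/-! ### Families of maps between normed spaces which are smooth on slices -/

section SliceSmooth

variable {V W W' : Type*} [NormedAddCommGroup V] [NormedSpace ℝ V]
  [NormedAddCommGroup W] [NormedSpace ℝ W] [NormedAddCommGroup W'] [NormedSpace ℝ W']

/-- A map on a subset of `I × V` which is smooth on each slice `{t} × V`, all derivatives in the
direction of the slice being jointly continuous. -/
structure SliceSmoothOn (f : I × V → W) (U : Set (I × V)) : Prop where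
  contDiffAt : ∀ q ∈ U, ContDiffAt ℝ ∞ (fun v => f (q.1, v)) q.2
  continuousOn_iteratedFDeriv : ∀ k : ℕ,
    ContinuousOn (fun q : I × V => iteratedFDeriv ℝ k (fun v => f (q.1, v)) q.2) U

lemma continuousOn_iteratedFDeriv_zero_iff {f : I × V → W} {U : Set (I × V)} :
    ContinuousOn (fun q : I × V => iteratedFDeriv ℝ 0 (fun v => f (q.1, v)) q.2) U ↔
      ContinuousOn f U := by
  simp only [iteratedFDeriv_zero_eq_comp]
  exact (continuousMultilinearCurryFin0 ℝ V W).symm.comp_continuousOn_iff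

namespace SliceSmoothOn

variable {f g : I × V → W} {U U' : Set (I × V)}

lemma continuousOn (hf : SliceSmoothOn f U) : ContinuousOn f U :=
  continuousOn_iteratedFDeriv_zero_iff.1 (hf.continuousOn_iteratedFDeriv 0)

lemma mono (hf : SliceSmoothOn f U) (h : U' ⊆ U) : SliceSmoothOn f U' :=
  ⟨fun q hq => hf.1 q (h hq), fun k => (hf.2 k).mono h⟩

omit [NormedSpace ℝ V] [NormedAddCommGroup W] [NormedSpace ℝ W] in
lemma eventuallyEq_slice (hU : IsOpen U) (h : EqOn f g U) {q : I × V} (hq : q ∈ U) :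
    (fun v => f (q.1, v)) =ᶠ[𝓝 q.2] fun v => g (q.1, v) := by
  have h1 : ∀ᶠ v in 𝓝 q.2, (q.1, v) ∈ U :=
    (Continuous.prodMk_right q.1).continuousAt.eventually (hU.mem_nhds hq)
  exact h1.mono fun v hv => h hv

lemma congr (hf : SliceSmoothOn f U) (hU : IsOpen U) (h : EqOn f g U) : SliceSmoothOn g U := by
  refine ⟨fun q hq => (hf.1 q hq).congr_of_eventuallyEq (eventuallyEq_slice hU h hq).symm,
    fun k => (hf.2 k).congr fun q hq => ?_⟩
  exact ((eventuallyEq_slice hU h hq).symm.iteratedFDeriv ℝ k).eq_of_nhds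

lemma of_locally (h : ∀ q ∈ U, ∃ U', IsOpen U' ∧ q ∈ U' ∧ SliceSmoothOn f U') :
    SliceSmoothOn f U := by
  refine ⟨fun q hq => ?_, fun k q hq => ?_⟩
  · obtain ⟨U', -, hq', h'⟩ := h q hq
    exact h'.1 q hq'
  · obtain ⟨U', hU', hq', h'⟩ := h q hq
    exact ((h'.2 k).continuousAt (hU'.mem_nhds hq')).continuousWithinAt

/-- Up to a currying isometry, the derivative of order `k` of the slice derivative is the derivative
of order `k + 1`. This stability drives the induction on the order of smoothness below. -/
lemma fderiv (hf : SliceSmoothOn f U) :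
    SliceSmoothOn (fun q : I × V => fderiv ℝ (fun v => f (q.1, v)) q.2) U := by
  refine ⟨fun q hq => ?_, fun k => ?_⟩
  · exact (hf.1 q hq).fderiv_right (m := ∞) (by simp)
  · have h := hf.2 (k + 1)
    simp only [iteratedFDeriv_succ_eq_comp_right] at h
    exact (continuousMultilinearCurryRightEquiv' ℝ k V W).symm.comp_continuousOn_iff.1 h

/-- By Faà di Bruno's formula the higher derivatives of a composite are finite sums of multilinear
expressions in those of the factors, so joint continuity is inherited. -/
lemma comp {g : I × W → W'} {f : I × V → W} {U : Set (I × V)} {U' : Set (I × W)}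
    (hg : SliceSmoothOn g U') (hf : SliceSmoothOn f U) (h : ∀ q ∈ U, (q.1, f q) ∈ U') :
    SliceSmoothOn (fun q => g (q.1, f q)) U := by
  refine ⟨fun q hq => ContDiffAt.comp (g := fun w => g (q.1, w))
    (f := fun v => f (q.1, v)) q.2 (hg.1 _ (h q hq)) (hf.1 q hq), fun k => ?_⟩
  have hc : ContinuousOn (fun q : I × V => (q.1, f q)) U :=
    continuous_fst.continuousOn.prodMk hf.continuousOn
  have key : ∀ q ∈ U, iteratedFDeriv ℝ k (fun v => g (q.1, f (q.1, v))) q.2 =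
      ∑ c : OrderedFinpartition k, c.compAlongOrderedFinpartitionL ℝ V W W'
        (iteratedFDeriv ℝ c.length (fun w => g (q.1, w)) (f q))
        (fun m => iteratedFDeriv ℝ (c.partSize m) (fun v => f (q.1, v)) q.2) := fun q hq =>
    iteratedFDeriv_comp (n := ∞) (g := fun w => g (q.1, w)) (f := fun v => f (q.1, v)) (x := q.2)
      (hg.1 _ (h q hq)) (hf.1 q hq) (by exact_mod_cast le_top)
  refine ContinuousOn.congr (continuousOn_finsetSum _ fun c _ => ?_) key
  have h1 : ContinuousOn (fun q : I × V => c.compAlongOrderedFinpartitionL ℝ V W W'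
        (iteratedFDeriv ℝ c.length (fun w => g (q.1, w)) (f q))) U :=
    (ContinuousLinearMap.continuous _).comp_continuousOn ((hg.2 c.length).comp hc h)
  have h2 : ContinuousOn (fun q : I × V => fun m =>
      iteratedFDeriv ℝ (c.partSize m) (fun v => f (q.1, v)) q.2) U :=
    continuousOn_pi.2 fun m => hf.2 _
  exact h1.eval h2

end SliceSmoothOn

lemma sliceSmoothOn_const {g : V → W} {s : Set V} (hs : IsOpen s) (hg : ContDiffOn ℝ ∞ g s) :
    SliceSmoothOn (fun q : I × V => g q.2) {q | q.2 ∈ s} := by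
  refine ⟨fun q hq => hg.contDiffAt (hs.mem_nhds hq), fun k => ?_⟩
  have h : ContinuousOn (iteratedFDeriv ℝ k g) s :=
    (hg.continuousOn_iteratedFDerivWithin (m := k) (by exact_mod_cast le_top)
      hs.uniqueDiffOn).congr fun x hx => (iteratedFDerivWithin_of_isOpen k hs hx).symm
  exact h.comp continuous_snd.continuousOn fun q hq => hq

/-- Continuity of `a` is enough: the parameter enters only the derivative of order zero, and all
others agree with those of the identity. -/
lemma sliceSmoothOn_translate {a : I → V} (ha : Continuous a) (U : Set (I × V)) :
    SliceSmoothOn (fun q : I × V => q.2 + a q.1) U := by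
  refine ⟨fun q _ => ContDiff.contDiffAt (f := fun v => v + a q.1)
    (contDiff_id.add contDiff_const), fun k => ?_⟩
  rcases k with _ | k
  · exact continuousOn_iteratedFDeriv_zero_iff.2
      (continuous_snd.add (ha.comp continuous_fst)).continuousOn
  · have : (fun q : I × V => iteratedFDeriv ℝ (k + 1) (fun v => v + a q.1) q.2) =
        fun q : I × V => iteratedFDeriv ℝ (k + 1) (id : V → V) q.2 := by
      ext1 q
      simp only [iteratedFDeriv_succ_eq_comp_right, fderiv_add_const]
      rfl
    simp only [this]
    exact ((contDiff_id (n := ∞)).continuous_iteratedFDeriv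
      (by exact_mod_cast le_top)).comp_continuousOn continuous_snd.continuousOn

end SliceSmooth

/-! ### Superposition operators -/

section Superposition

variable {V W : Type*} [NormedAddCommGroup V] [NormedSpace ℝ V]
  [NormedAddCommGroup W] [NormedSpace ℝ W]

/-- Sending `η` to its graph is continuous, and mapping the compact interval into `U` is an open
condition in the compact-open topology. -/
lemma isOpen_setOf_forall_mem {X : Type*} [TopologicalSpace X] {U : Set (I × X)} (hU : IsOpen U) :
    IsOpen {η : C(I, X) | ∀ t, (t, η t) ∈ U} := by
  have h : Continuous fun η : C(I, X) => (ContinuousMap.id I).prodMk η :=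
    ContinuousMap.continuous_of_continuous_uncurry _ (by
      have h : Continuous fun p : C(I, X) × I => (p.2, p.1 p.2) := by fun_prop
      exact h)
  convert! (ContinuousMap.isOpen_setOfPred_mapsTo (K := (univ : Set I)) isCompact_univ hU).preimage h
    using 1
  ext η
  simp [MapsTo]

open Classical in
/-- The superposition operator `η ↦ (t ↦ f (t, η t))`. -/
noncomputable def superposition {X Y : Type*} [TopologicalSpace X] [TopologicalSpace Y] [Nonempty Y]
    (f : I × X → Y) (η : C(I, X)) : C(I, Y) :=
  -- The constant path is a junk value. It makes the operator total on `C(I, X)`, so that it can be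
  -- differentiated without subtypes.
  if h : Continuous fun t => f (t, η t) then ⟨_, h⟩ else .const I (Classical.arbitrary Y)

section
variable {X Y : Type*} [TopologicalSpace X] [TopologicalSpace Y] [Nonempty Y]
  {f : I × X → Y} {U : Set (I × X)}

lemma superposition_apply (hf : ContinuousOn f U) {η : C(I, X)} (hη : ∀ t, (t, η t) ∈ U) (t : I) :
    superposition f η t = f (t, η t) := by
  have h : Continuous fun t => f (t, η t) := hf.comp_continuous (by fun_prop) hη
  simp [superposition, h]

lemma continuousOn_superposition (hf : ContinuousOn f U) :
    ContinuousOn (superposition f) {η | ∀ t, (t, η t) ∈ U} := by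
  rw [continuousOn_iff_continuous_domRestrict]
  refine ContinuousMap.continuous_of_continuous_uncurry _ ?_
  have : Continuous fun p : {η : C(I, X) | ∀ t, (t, η t) ∈ U} × I => f (p.2, p.1.1 p.2) :=
    hf.comp_continuous (by fun_prop) fun p => p.1.2 p.2
  exact this.congr fun p => (superposition_apply hf p.1.2 p.2).symm
end

/-- The continuous bilinear pairing of paths of operators and paths of vectors. -/
noncomputable def pathApply (V W : Type*) [NormedAddCommGroup V] [NormedSpace ℝ V]
    [NormedAddCommGroup W] [NormedSpace ℝ W] : C(I, V →L[ℝ] W) →L[ℝ] C(I, V) →L[ℝ] C(I, W) :=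
  LinearMap.mkContinuous₂
    (LinearMap.mk₂ ℝ (fun (A : C(I, V →L[ℝ] W)) (η : C(I, V)) =>
        (⟨fun t => A t (η t), by fun_prop⟩ : C(I, W)))
      (fun _ _ _ => by ext; simp) (fun _ _ _ => by ext; simp)
      (fun _ _ _ => by ext; simp) (fun _ _ _ => by ext; simp)) 1 fun A η => by
    rw [one_mul]
    refine (ContinuousMap.norm_le _ (by positivity)).2 fun t => ?_
    exact ((A t).le_opNorm (η t)).trans
      (mul_le_mul (A.norm_coe_le_norm t) (η.norm_coe_le_norm t) (norm_nonneg _) (by positivity))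

@[simp] lemma pathApply_apply (A : C(I, V →L[ℝ] W)) (η : C(I, V)) (t : I) :
    pathApply V W A η t = A t (η t) := rfl

lemma contDiff_pathApply {k : WithTop ℕ∞} : ContDiff ℝ k (pathApply V W) :=
  ContinuousLinearMap.contDiff (𝕜 := ℝ) (E := C(I, V →L[ℝ] W)) (F := C(I, V) →L[ℝ] C(I, W)) _

omit [NormedSpace ℝ V] [NormedSpace ℝ W] in
-- Compactness of `I` gives a single `δ` for all times, which converts pointwise estimates into
-- estimates in the supremum norm.
lemma exists_tube {f : I × V → W} {U : Set (I × V)} (hU : IsOpen U) (hf : ContinuousOn f U)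
    {η : C(I, V)} (hη : ∀ t, (t, η t) ∈ U) {ε : ℝ} (hε : 0 < ε) :
    ∃ δ > 0, ∀ t v, ‖v‖ < δ → (t, η t + v) ∈ U ∧ ‖f (t, η t + v) - f (t, η t)‖ < ε := by
  have hO : ∀ t : I, ∀ᶠ p : I × V in 𝓝 (t, 0),
      (p.1, η p.1 + p.2) ∈ U ∧ ‖f (p.1, η p.1 + p.2) - f (p.1, η p.1)‖ < ε := by
    intro t
    have hc : ContinuousAt (fun p : I × V => (p.1, η p.1 + p.2)) (t, 0) := by fun_prop
    have hc' : ContinuousAt (fun p : I × V => (p.1, η p.1)) (t, 0) := by fun_prop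
    have ht : U ∈ 𝓝 (t, η t + (0 : V)) := by simpa using hU.mem_nhds (hη t)
    refine (hc.eventually ht).and ?_
    have h1 : ContinuousAt (fun p : I × V => f (p.1, η p.1 + p.2)) (t, 0) :=
      ContinuousAt.comp (g := f) (f := fun p : I × V => (p.1, η p.1 + p.2)) (hf.continuousAt ht) hc
    have h2 : ContinuousAt (fun p : I × V => f (p.1, η p.1)) (t, 0) :=
      ContinuousAt.comp (g := f) (f := fun p : I × V => (p.1, η p.1))
        (hf.continuousAt (hU.mem_nhds (hη t))) hc'
    have h3 := (h1.sub h2).norm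
    exact h3.eventually (gt_mem_nhds (by simpa using hε))
  -- Tube lemma: the local conditions around each `(t, 0)` combine to one neighbourhood of `0` valid
  -- for every `t`.
  have h := (isCompact_univ (X := I)).mem_prod_nhdsSet_of_forall
    (l := 𝓝 (0 : V)) (s := {p : V × I | (p.2, η p.2 + p.1) ∈ U ∧
      ‖f (p.2, η p.2 + p.1) - f (p.2, η p.2)‖ < ε}) (fun t _ => by
        rw [← nhds_prod_eq]
        exact (continuous_swap.tendsto ((0 : V), t)).eventually (hO t))
  rw [nhdsSet_univ, Filter.mem_prod_top] at h
  obtain ⟨δ, hδ, h⟩ := Metric.mem_nhds_iff.1 h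
  exact ⟨δ, hδ, fun t v hv => h (by simpa using hv) t⟩

/-- On each slice the mean value inequality bounds the remainder by the oscillation of the slice
derivative. The tube around `η` makes that oscillation small uniformly in `t`. -/
lemma hasFDerivAt_superposition {f : I × V → W} {U : Set (I × V)} (hU : IsOpen U)
    (hf : SliceSmoothOn f U) {η : C(I, V)} (hη : ∀ t, (t, η t) ∈ U) :
    HasFDerivAt (superposition f)
      (pathApply V W (superposition (fun q : I × V => fderiv ℝ (fun v => f (q.1, v)) q.2) η)) η := by
  rw [hasFDerivAt_iff_isLittleO_nhds_zero, Asymptotics.isLittleO_iff]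
  intro ε hε
  obtain ⟨δ, hδ, h⟩ := exists_tube hU hf.fderiv.continuousOn hη hε
  filter_upwards [Metric.ball_mem_nhds (0 : C(I, V)) hδ] with ξ hξ
  have hξ' : ∀ t, ‖ξ t‖ < δ := fun t =>
    (ξ.norm_coe_le_norm t).trans_lt (by simpa using hξ)
  have hmem : ∀ t, (t, (η + ξ) t) ∈ U := fun t => (h t _ (hξ' t)).1
  refine (ContinuousMap.norm_le _ (by positivity)).2 fun t => ?_
  simp only [ContinuousMap.sub_apply, pathApply_apply]
  rw [superposition_apply hf.continuousOn hmem, superposition_apply hf.continuousOn hη,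
    superposition_apply hf.fderiv.continuousOn hη]
  have hmv := (convex_ball (0 : V) δ).norm_image_sub_le_of_norm_hasFDerivWithin_le'
    (f := fun v => f (t, η t + v)) (f' := fun v => _root_.fderiv ℝ (fun w => f (t, w)) (η t + v))
    (φ := _root_.fderiv ℝ (fun w => f (t, w)) (η t)) (C := ε) (x := 0) (y := ξ t)
    (fun v hv => ?_) (fun v hv => ?_) (by simpa using hδ) (by simpa using hξ' t)
  · simp only [add_zero, sub_zero] at hmv
    refine hmv.trans ?_
    gcongr
    exact ξ.norm_coe_le_norm t
  · have h1 := ((hf.contDiffAt _ (h t v (by simpa using hv)).1).differentiableAt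
      (by simp)).hasFDerivAt
    exact ((hasFDerivAt_comp_add_left (η t)).2 h1).hasFDerivWithinAt
  · exact (h t v (by simpa using hv)).2.le

/-- The derivative is `pathApply` after another superposition operator, now with values in `V →L[ℝ]
W`. The induction therefore quantifies over the target, and the common universe keeps this operator
space within its range. -/
lemma contDiffOn_superposition_nat.{u} {V : Type u} [NormedAddCommGroup V] [NormedSpace ℝ V]
    {U : Set (I × V)} (hU : IsOpen U) (k : ℕ) :
    ∀ {W : Type u} [NormedAddCommGroup W] [NormedSpace ℝ W] {f : I × V → W}
    (_ : SliceSmoothOn f U), ContDiffOn ℝ k (superposition f) {η | ∀ t, (t, η t) ∈ U} := by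
  induction k with
  | zero =>
    intro W _ _ f hf
    exact contDiffOn_zero.2 (continuousOn_superposition hf.continuousOn)
  | succ k ih =>
    intro W _ _ f hf
    have hd : ∀ η ∈ {η : C(I, V) | ∀ t, (t, η t) ∈ U}, HasFDerivAt (superposition f) (pathApply V W
        (superposition (fun q : I × V => fderiv ℝ (fun v => f (q.1, v)) q.2) η)) η :=
      fun η hη => hasFDerivAt_superposition hU hf hη
    rw [Nat.cast_succ, contDiffOn_succ_iff_fderiv_of_isOpen (isOpen_setOf_forall_mem hU)]
    refine ⟨fun η hη => (hd η hη).differentiableAt.differentiableWithinAt, by simp, ?_⟩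
    have h : ContDiffOn ℝ k (fun η => pathApply V W
        (superposition (fun q : I × V => fderiv ℝ (fun v => f (q.1, v)) q.2) η))
        {η | ∀ t, (t, η t) ∈ U} := contDiff_pathApply.comp_contDiffOn (ih hf.fderiv)
    exact h.congr fun η hη => (hd η hη).fderiv

theorem contDiffOn_superposition.{u} {V W : Type u} [NormedAddCommGroup V] [NormedSpace ℝ V]
    [NormedAddCommGroup W] [NormedSpace ℝ W] {U : Set (I × V)} (hU : IsOpen U) {f : I × V → W}
    (hf : SliceSmoothOn f U) : ContDiffOn ℝ ∞ (superposition f) {η | ∀ t, (t, η t) ∈ U} :=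
  contDiffOn_infty.2 fun k => contDiffOn_superposition_nat hU k hf

end Superposition

/-! ### Families of maps between manifolds which are smooth on slices -/

section SliceMDiff

variable {V V' V'' N N' N'' : Type*}
  [NormedAddCommGroup V] [NormedSpace ℝ V] [NormedAddCommGroup V'] [NormedSpace ℝ V']
  [NormedAddCommGroup V''] [NormedSpace ℝ V'']
  [TopologicalSpace N] [ChartedSpace V N] [TopologicalSpace N'] [ChartedSpace V' N']
  [TopologicalSpace N''] [ChartedSpace V'' N'']

variable (V V') in
/-- A family of maps between manifolds, parametrised by `I`, which is jointly continuous together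
with all its derivatives along the slices. -/
structure SliceMDiffOn (f : I × N → N') (U : Set (I × N)) : Prop where
  continuousOn : ContinuousOn f U
  sliceSmoothOn : ∀ κ ∈ atlas V N, ∀ κ' ∈ atlas V' N',
    SliceSmoothOn (fun q : I × V => κ' (f (q.1, κ.symm q.2)))
      {q | q.2 ∈ κ.target ∧ (q.1, κ.symm q.2) ∈ U ∧ f (q.1, κ.symm q.2) ∈ κ'.source}

omit [ChartedSpace V N] [NormedSpace ℝ V] in
lemma isOpen_chart_preimage (κ : OpenPartialHomeomorph N V) {W : Set (I × N)} (hW : IsOpen W) :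
    IsOpen {q : I × V | q.2 ∈ κ.target ∧ (q.1, κ.symm q.2) ∈ W} := by
  have hc : ContinuousOn (fun q : I × V => (q.1, κ.symm q.2)) {q | q.2 ∈ κ.target} :=
    continuous_fst.continuousOn.prodMk
      (κ.continuousOn_symm.comp continuous_snd.continuousOn fun q hq => hq)
  exact hc.isOpen_inter_preimage (κ.open_target.preimage continuous_snd) hW

namespace SliceMDiffOn

variable {f g : I × N → N'} {U U' : Set (I × N)}

omit [NormedSpace ℝ V] [NormedSpace ℝ V'] [ChartedSpace V N] [ChartedSpace V' N'] in
lemma isOpen_chart_domain (hf : ContinuousOn f U) (hU : IsOpen U)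
    (κ : OpenPartialHomeomorph N V) (κ' : OpenPartialHomeomorph N' V') :
    IsOpen {q : I × V | q.2 ∈ κ.target ∧ (q.1, κ.symm q.2) ∈ U ∧
      f (q.1, κ.symm q.2) ∈ κ'.source} :=
  isOpen_chart_preimage κ (hf.isOpen_inter_preimage hU κ'.open_source)

lemma mono (hf : SliceMDiffOn V V' f U) (h : U' ⊆ U) : SliceMDiffOn V V' f U' :=
  ⟨hf.1.mono h, fun κ hκ κ' hκ' => (hf.2 κ hκ κ' hκ').mono fun _ hq => ⟨hq.1, h hq.2.1, hq.2.2⟩⟩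

lemma congr (hf : SliceMDiffOn V V' f U) (hU : IsOpen U) (h : EqOn f g U) :
    SliceMDiffOn V V' g U := by
  refine ⟨hf.1.congr h.symm, fun κ hκ κ' hκ' => ?_⟩
  refine ((hf.2 κ hκ κ' hκ').congr (isOpen_chart_domain hf.1 hU κ κ')
    fun q hq => congrArg κ' (h hq.2.1)).mono fun q hq => ⟨hq.1, hq.2.1, ?_⟩
  rw [h hq.2.1]
  exact hq.2.2

lemma of_locally (h : ∀ p ∈ U, ∃ U', IsOpen U' ∧ p ∈ U' ∧ SliceMDiffOn V V' f U') :
    SliceMDiffOn V V' f U := by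
  refine ⟨fun p hp => ?_, fun κ hκ κ' hκ' => SliceSmoothOn.of_locally fun q hq => ?_⟩
  · obtain ⟨U', hU', hp', h'⟩ := h p hp
    exact (h'.1.continuousAt (hU'.mem_nhds hp')).continuousWithinAt
  · obtain ⟨U', hU', hq', h'⟩ := h _ hq.2.1
    exact ⟨_, isOpen_chart_domain h'.1 hU' κ κ', ⟨hq.1, hq', hq.2.2⟩, h'.2 κ hκ κ' hκ'⟩

/-- Locally the intermediate values lie in one chart `κ'`. Inserting `κ'` and its inverse reduces
the claim to composition between normed spaces. -/
lemma comp {g : I × N' → N''} {U' : Set (I × N')} (hg : SliceMDiffOn V' V'' g U')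
    (hf : SliceMDiffOn V V' f U) (hU : IsOpen U)
    (h : ∀ p ∈ U, (p.1, f p) ∈ U') : SliceMDiffOn V V'' (fun p => g (p.1, f p)) U := by
  have hc : ContinuousOn (fun p : I × N => (p.1, f p)) U := continuous_fst.continuousOn.prodMk hf.1
  refine ⟨hg.1.comp hc h, fun κ hκ κ'' hκ'' => SliceSmoothOn.of_locally fun q₀ hq₀ => ?_⟩
  set κ' := chartAt V' (f (q₀.1, κ.symm q₀.2)) with hκ'
  have hκ'a : κ' ∈ atlas V' N' := chart_mem_atlas V' _
  have hW : IsOpen ((U ∩ f ⁻¹' κ'.source) ∩ (fun p => g (p.1, f p)) ⁻¹' κ''.source) :=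
    ((hg.1.comp hc h).mono inter_subset_left).isOpen_inter_preimage
      (hf.1.isOpen_inter_preimage hU κ'.open_source) κ''.open_source
  have hO := isOpen_chart_preimage κ hW
  refine ⟨_, hO, ⟨hq₀.1, ⟨hq₀.2.1, mem_chart_source _ _⟩, hq₀.2.2⟩, ?_⟩
  refine SliceSmoothOn.congr (SliceSmoothOn.comp (hg.2 κ' hκ'a κ'' hκ'')
    ((hf.2 κ hκ κ' hκ'a).mono fun q hq => ⟨hq.1, hq.2.1.1, hq.2.1.2⟩)
    fun q hq => ?_) hO fun q hq => ?_
  · have hs : f (q.1, κ.symm q.2) ∈ κ'.source := hq.2.1.2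
    refine ⟨κ'.map_source hs, ?_, ?_⟩
    · simpa only [κ'.left_inv hs] using h _ hq.2.1.1
    · have h3 : g (q.1, f (q.1, κ.symm q.2)) ∈ κ''.source := hq.2.2
      simpa only [κ'.left_inv hs] using h3
  · have hs : f (q.1, κ.symm q.2) ∈ κ'.source := hq.2.1.2
    simp only [κ'.left_inv hs]

end SliceMDiffOn

lemma sliceMDiffOn_self_iff {f : I × V → N'} {U : Set (I × V)} :
    SliceMDiffOn V V' f U ↔ ContinuousOn f U ∧ ∀ κ' ∈ atlas V' N',
      SliceSmoothOn (fun q : I × V => κ' (f q)) {q | q ∈ U ∧ f q ∈ κ'.source} := by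
  constructor
  · rintro ⟨h1, h2⟩
    refine ⟨h1, fun κ' hκ' => ?_⟩
    simpa using h2 (OpenPartialHomeomorph.refl V) (by simp) κ' hκ'
  · rintro ⟨h1, h2⟩
    refine ⟨h1, fun κ hκ κ' hκ' => ?_⟩
    obtain rfl : κ = OpenPartialHomeomorph.refl V := by simpa using hκ
    simpa using h2 κ' hκ'

lemma sliceMDiffOn_to_self_iff {f : I × N → V'} {U : Set (I × N)} :
    SliceMDiffOn V V' f U ↔ ContinuousOn f U ∧ ∀ κ ∈ atlas V N,
      SliceSmoothOn (fun q : I × V => f (q.1, κ.symm q.2))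
        {q | q.2 ∈ κ.target ∧ (q.1, κ.symm q.2) ∈ U} := by
  constructor
  · rintro ⟨h1, h2⟩
    refine ⟨h1, fun κ hκ => ?_⟩
    simpa using h2 κ hκ (OpenPartialHomeomorph.refl V') (by simp)
  · rintro ⟨h1, h2⟩
    refine ⟨h1, fun κ hκ κ' hκ' => ?_⟩
    obtain rfl : κ' = OpenPartialHomeomorph.refl V' := by simpa using hκ'
    simpa using h2 κ hκ

lemma sliceMDiffOn_self_self_iff {f : I × V → V'} {U : Set (I × V)} :
    SliceMDiffOn V V' f U ↔ SliceSmoothOn f U := by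
  rw [sliceMDiffOn_self_iff]
  simp only [chartedSpaceSelf_atlas, forall_eq]
  simp only [OpenPartialHomeomorph.refl_apply, OpenPartialHomeomorph.refl_source, mem_univ,
    and_true, ofPred_mem_eq]
  exact ⟨fun h => h.2, fun h => ⟨h.continuousOn, h⟩⟩

lemma sliceMDiffOn_const [IsManifold 𝓘(ℝ, V) ∞ N] [IsManifold 𝓘(ℝ, V') ∞ N'] {g : N → N'}
    {s : Set N} (hs : IsOpen s) (hg : ContMDiffOn 𝓘(ℝ, V) 𝓘(ℝ, V') ∞ g s) :
    SliceMDiffOn V V' (fun q : I × N => g q.2) {q | q.2 ∈ s} := by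
  have hc : ContinuousOn (fun q : I × N => g q.2) {q | q.2 ∈ s} :=
    hg.continuousOn.comp continuous_snd.continuousOn fun _ hq => hq
  refine ⟨hc, fun κ hκ κ' hκ' => ?_⟩
  have ho : IsOpen {v | v ∈ κ.target ∧ κ.symm v ∈ s ∧ g (κ.symm v) ∈ κ'.source} :=
    κ.continuousOn_symm.isOpen_inter_preimage κ.open_target
      (hg.continuousOn.isOpen_inter_preimage hs κ'.open_source)
  refine sliceSmoothOn_const (g := fun v => κ' (g (κ.symm v))) ho ?_
  rw [← contMDiffOn_iff_contDiffOn]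
  have h1 : ContMDiffOn 𝓘(ℝ, V) 𝓘(ℝ, V) ∞ κ.symm κ.target :=
    contMDiffOn_symm_of_mem_maximalAtlas (IsManifold.subset_maximalAtlas hκ)
  have h2 : ContMDiffOn 𝓘(ℝ, V') 𝓘(ℝ, V') ∞ κ' κ'.source :=
    contMDiffOn_of_mem_maximalAtlas (IsManifold.subset_maximalAtlas hκ')
  exact h2.comp (hg.comp (h1.mono fun v hv => hv.1) fun v hv => hv.2.1) fun v hv => hv.2.2

/-- Repackages the conditions in charts so that composition and gluing apply. Smoothness on a slice
and at its points agree because the domains involved are open. -/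
lemma isSmoothFamily_iff {Φ : I → OpenPartialHomeomorph V N} :
    IsSmoothFamily Φ ↔ IsOpen {q : I × V | q.2 ∈ (Φ q.1).source} ∧
      IsOpen {q : I × N | q.2 ∈ (Φ q.1).target} ∧
      SliceMDiffOn V V (fun q : I × V => Φ q.1 q.2) {q | q.2 ∈ (Φ q.1).source} ∧
      SliceMDiffOn V V (fun q : I × N => (Φ q.1).symm q.2) {q | q.2 ∈ (Φ q.1).target} := by
  rw [sliceMDiffOn_self_iff, sliceMDiffOn_to_self_iff]
  constructor
  · intro h
    refine ⟨h.1, h.2, ⟨h.3, fun κ hκ => ⟨fun q hq => ?_, h.7 κ hκ⟩⟩,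
      ⟨h.4, fun κ hκ => ⟨fun q hq => ?_, h.8 κ hκ⟩⟩⟩
    · refine (h.5 κ hκ q.1).contDiffAt (IsOpen.mem_nhds ?_ hq)
      exact (Φ q.1).continuousOn.isOpen_inter_preimage (Φ q.1).open_source κ.open_source
    · refine (h.6 κ hκ q.1).contDiffAt (IsOpen.mem_nhds ?_ hq)
      exact κ.continuousOn_symm.isOpen_inter_preimage κ.open_target (Φ q.1).open_target
  · rintro ⟨h1, h2, ⟨h3, h4⟩, h5, h6⟩
    exact ⟨h1, h2, h3, h5,
      fun κ hκ t v hv => ((h4 κ hκ).1 (t, v) hv).contDiffWithinAt,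
      fun κ hκ t v hv => ((h6 κ hκ).1 (t, v) hv).contDiffWithinAt,
      fun κ hκ k => (h4 κ hκ).2 k, fun κ hκ k => (h6 κ hκ).2 k⟩

end SliceMDiff

/-! ### Standard charts of path spaces -/

section PathCharts

variable {V N : Type*} [NormedAddCommGroup V] [NormedSpace ℝ V] [TopologicalSpace N]

/-- The projection from the space of all paths in `V` to the space of paths vanishing at the
endpoints, which subtracts an affine path. -/
noncomputable def pathProj (V : Type*) [NormedAddCommGroup V] [NormedSpace ℝ V] :
    C(I, V) →L[ℝ] pathModel V where
  toFun η := ⟨⟨fun t => η t - (1 - (t : ℝ)) • η 0 - (t : ℝ) • η 1, by fun_prop⟩,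
    ⟨by simp, by simp⟩⟩
  map_add' η ξ := by
    ext t
    simp only [ContinuousMap.add_apply, smul_add, ContinuousMap.coe_mk, Submodule.coe_add]
    abel
  map_smul' c η := by
    ext t
    simp only [ContinuousMap.smul_apply, ContinuousMap.coe_mk, Submodule.coe_smul, smul_sub,
      smul_comm c, RingHom.id_apply]
  cont := by
    refine Continuous.subtype_mk (ContinuousMap.continuous_of_continuous_uncurry _ ?_) _
    change Continuous fun p : C(I, V) × I =>
      p.1 p.2 - (1 - (p.2 : ℝ)) • p.1 0 - (p.2 : ℝ) • p.1 1
    fun_prop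

/-- As a linear retraction, `pathProj` permits maps into `pathModel V` to be written without a
membership proof, and costs no smoothness. -/
lemma pathProj_apply_of_mem {η : C(I, V)} (hη : η ∈ pathModel V) : pathProj V η = ⟨η, hη⟩ := by
  ext t
  have h0 : η 0 = 0 := hη.1
  have h1 : η 1 = 0 := hη.2
  change η t - (1 - (t : ℝ)) • η 0 - (t : ℝ) • η 1 = η t
  simp [h0, h1]

section
variable {y z : N}

lemma isOpen_setOf_path_mem {U : Set (I × N)} (hU : IsOpen U) :
    IsOpen {γ : Path y z | ∀ t, (t, γ t) ∈ U} :=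
  (isOpen_setOf_forall_mem hU).preimage continuous_induced_dom

lemma continuousOn_superposition_path {Y : Type*} [TopologicalSpace Y] [Nonempty Y]
    {f : I × N → Y} {U : Set (I × N)} (hf : ContinuousOn f U) :
    ContinuousOn (fun γ : Path y z => superposition f γ) {γ | ∀ t, (t, γ t) ∈ U} :=
  (continuousOn_superposition hf).comp continuous_induced_dom.continuousOn fun _ hγ => hγ

lemma superposition_path_apply {Y : Type*} [TopologicalSpace Y] [Nonempty Y]
    {f : I × N → Y} {U : Set (I × N)} (hf : ContinuousOn f U) {γ : Path y z}
    (hγ : ∀ t, (t, γ t) ∈ U) (t : I) : superposition f γ t = f (t, γ t) :=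
  superposition_apply (η := (γ : C(I, N))) hf hγ t

variable [ChartedSpace V N]

lemma superposition_symm_mem_pathModel {Φ : I → OpenPartialHomeomorph V N} (hΦ : IsSmoothFamily Φ)
    (h0 : 0 ∈ (Φ 0).source ∧ Φ 0 0 = y) (h1 : 0 ∈ (Φ 1).source ∧ Φ 1 0 = z)
    {γ : Path y z} (hγ : ∀ t, γ t ∈ (Φ t).target) :
    superposition (fun q : I × N => (Φ q.1).symm q.2) γ ∈ pathModel V := by
  constructor
  · rw [superposition_path_apply hΦ.continuousOn_symm hγ, γ.source, ← h0.2]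
    exact (Φ 0).left_inv h0.1
  · rw [superposition_path_apply hΦ.continuousOn_symm hγ, γ.target, ← h1.2]
    exact (Φ 1).left_inv h1.1

open Classical in
/-- The standard chart of the space of paths from `y` to `z` defined by a smooth family. -/
noncomputable def familyChart {Φ : I → OpenPartialHomeomorph V N} (hΦ : IsSmoothFamily Φ)
    (h0 : 0 ∈ (Φ 0).source ∧ Φ 0 0 = y) (h1 : 0 ∈ (Φ 1).source ∧ Φ 1 0 = z) (γ₀ : Path y z) :
    OpenPartialHomeomorph (Path y z) (pathModel V) :=
  haveI : Nonempty N := ⟨y⟩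
  have hto : ∀ γ : Path y z, (∀ t, γ t ∈ (Φ t).target) → ∀ t,
      (pathProj V (superposition (fun q : I × N => (Φ q.1).symm q.2) γ)).1 t =
        (Φ t).symm (γ t) := by
    intro γ hγ t
    rw [pathProj_apply_of_mem (superposition_symm_mem_pathModel hΦ h0 h1 hγ)]
    exact superposition_path_apply hΦ.continuousOn_symm hγ t
  { toFun γ := pathProj V (superposition (fun q : I × N => (Φ q.1).symm q.2) γ)
    invFun η := if h : ∀ t, η.1 t ∈ (Φ t).source then
      { toContinuousMap := superposition (fun q : I × V => Φ q.1 q.2) η.1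
        source' := by
          refine (superposition_apply hΦ.continuousOn h 0).trans ?_
          simp only [η.2.1, h0.2]
        target' := by
          refine (superposition_apply hΦ.continuousOn h 1).trans ?_
          simp only [η.2.2, h1.2] }
      -- Junk value outside the target of the chart. The path `γ₀` only makes the inverse a total
      -- function.
      else γ₀
    source := {γ | ∀ t, γ t ∈ (Φ t).target}
    target := {η | ∀ t, η.1 t ∈ (Φ t).source}
    map_source' γ hγ t := by
      rw [hto γ hγ]
      exact (Φ t).map_target (hγ t)
    map_target' η hη := by
      have h : ∀ t, η.1 t ∈ (Φ t).source := hη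
      rw [dif_pos h]
      intro t
      change superposition (fun q : I × V => Φ q.1 q.2) η.1 t ∈ _
      rw [superposition_apply hΦ.continuousOn h]
      exact (Φ t).map_source (h t)
    left_inv' γ hγ := by
      have h : ∀ t, (pathProj V (superposition (fun q : I × N => (Φ q.1).symm q.2) γ)).1 t ∈
          (Φ t).source := fun t => by
        rw [hto γ hγ]
        exact (Φ t).map_target (hγ t)
      rw [dif_pos h]
      ext t
      refine (superposition_apply hΦ.continuousOn h t).trans ?_
      simp only [hto γ hγ, (Φ t).right_inv (hγ t)]
    right_inv' η hη := by
      have h : ∀ t, η.1 t ∈ (Φ t).source := hη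
      have h' : ∀ t, superposition (fun q : I × V => Φ q.1 q.2) η.1 t = Φ t (η.1 t) :=
        superposition_apply hΦ.continuousOn h
      rw [dif_pos h]
      ext t
      rw [hto _ fun t => by
        change superposition (fun q : I × V => Φ q.1 q.2) η.1 t ∈ _
        rw [h']
        exact (Φ t).map_source (h t)]
      change (Φ t).symm (superposition (fun q : I × V => Φ q.1 q.2) η.1 t) = _
      rw [h', (Φ t).left_inv (h t)]
    open_source := isOpen_setOf_path_mem hΦ.isOpen_target
    open_target := (isOpen_setOf_forall_mem hΦ.isOpen_source).preimage continuous_subtype_val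
    continuousOn_toFun := (pathProj V).continuous.comp_continuousOn
      (continuousOn_superposition_path hΦ.continuousOn_symm)
    continuousOn_invFun := by
      have hc : ContinuousOn (fun η : pathModel V => superposition (fun q : I × V => Φ q.1 q.2) η.1)
          {η | ∀ t, η.1 t ∈ (Φ t).source} :=
        (continuousOn_superposition hΦ.continuousOn).comp
          continuous_subtype_val.continuousOn fun _ hη => hη
      refine (Topology.IsInducing.induced _).continuousOn_iff.2 (hc.congr fun η hη => ?_)
      have h : ∀ t, η.1 t ∈ (Φ t).source := hη
      simp only [Function.comp_def]
      rw [dif_pos h]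
      rfl }

lemma familyChart_source {Φ : I → OpenPartialHomeomorph V N} (hΦ : IsSmoothFamily Φ)
    (h0 : 0 ∈ (Φ 0).source ∧ Φ 0 0 = y) (h1 : 0 ∈ (Φ 1).source ∧ Φ 1 0 = z) (γ₀ : Path y z) :
    (familyChart hΦ h0 h1 γ₀).source = {γ | ∀ t, γ t ∈ (Φ t).target} := rfl

lemma familyChart_target {Φ : I → OpenPartialHomeomorph V N} (hΦ : IsSmoothFamily Φ)
    (h0 : 0 ∈ (Φ 0).source ∧ Φ 0 0 = y) (h1 : 0 ∈ (Φ 1).source ∧ Φ 1 0 = z) (γ₀ : Path y z) :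
    (familyChart hΦ h0 h1 γ₀).target = {η | ∀ t, η.1 t ∈ (Φ t).source} := rfl

lemma familyChart_apply {Φ : I → OpenPartialHomeomorph V N} (hΦ : IsSmoothFamily Φ)
    (h0 : 0 ∈ (Φ 0).source ∧ Φ 0 0 = y) (h1 : 0 ∈ (Φ 1).source ∧ Φ 1 0 = z) (γ₀ : Path y z)
    {γ : Path y z} (hγ : ∀ t, γ t ∈ (Φ t).target) (t : I) :
    (familyChart hΦ h0 h1 γ₀ γ).1 t = (Φ t).symm (γ t) := by
  change (pathProj V (superposition (fun q : I × N => (Φ q.1).symm q.2) γ)).1 t = _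
  rw [pathProj_apply_of_mem (superposition_symm_mem_pathModel hΦ h0 h1 hγ)]
  exact superposition_path_apply hΦ.continuousOn_symm hγ t

lemma isStandardPathChart_familyChart {Φ : I → OpenPartialHomeomorph V N} (hΦ : IsSmoothFamily Φ)
    (h0 : 0 ∈ (Φ 0).source ∧ Φ 0 0 = y) (h1 : 0 ∈ (Φ 1).source ∧ Φ 1 0 = z) (γ₀ : Path y z) :
    IsStandardPathChart (familyChart hΦ h0 h1 γ₀) :=
  ⟨Φ, hΦ, h0, h1, rfl, rfl, fun _ hγ t => familyChart_apply hΦ h0 h1 γ₀ hγ t⟩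

omit [ChartedSpace V N] in
/-- The local formula for the inverse of a standard chart. -/
lemma standardChart_symm_apply {c : OpenPartialHomeomorph (Path y z) (pathModel V)}
    {Φ : I → OpenPartialHomeomorph V N} (hs : c.source = {γ | ∀ t, γ t ∈ (Φ t).target})
    (hc : ∀ γ ∈ c.source, ∀ t, (c γ).1 t = (Φ t).symm (γ t)) {η : pathModel V}
    (hη : η ∈ c.target) (t : I) : c.symm η t = Φ t (η.1 t) := by
  have hγ := c.map_target hη
  have h := hc _ hγ t
  rw [c.right_inv hη] at h
  rw [h, (Φ t).right_inv]
  rw [hs] at hγ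
  exact hγ t

/-- In coordinates the transition is superposition with `(Φ' t).symm ∘ Φ t`, preceded by the
inclusion of `pathModel V` and followed by `pathProj`, both continuous linear. -/
theorem contDiffOn_standardChart_transition
    {c c' : OpenPartialHomeomorph (Path y z) (pathModel V)}
    (hc : IsStandardPathChart c) (hc' : IsStandardPathChart c') :
    ContDiffOn ℝ ∞ (c' ∘ c.symm) (c.symm.trans c').source := by
  obtain ⟨Φ, hΦ, -, -, hs, ht, hf⟩ := hc
  obtain ⟨Φ', hΦ', -, -, hs', -, hf'⟩ := hc'
  obtain ⟨o1, -, h1, -⟩ := isSmoothFamily_iff.1 hΦ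
  obtain ⟨-, o2', -, h2'⟩ := isSmoothFamily_iff.1 hΦ'
  set F : I × V → V := fun q => (Φ' q.1).symm (Φ q.1 q.2)
  set U : Set (I × V) := {q | q.2 ∈ (Φ q.1).source ∧ Φ q.1 q.2 ∈ (Φ' q.1).target}
  have hUo : IsOpen U :=
    (continuous_fst.continuousOn.prodMk h1.1).isOpen_inter_preimage o1 o2'
  have hFs : SliceSmoothOn F U := by
    rw [← sliceMDiffOn_self_self_iff]
    exact h2'.comp (h1.mono fun q hq => hq.1) hUo fun q hq => hq.2
  have hmaps : ∀ η ∈ (c.symm.trans c').source, ∀ t, (t, (η : pathModel V).1 t) ∈ U := by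
    rintro η ⟨hη, hη'⟩ t
    have hη'' : c.symm η ∈ c'.source := hη'
    rw [hs'] at hη''
    refine ⟨?_, ?_⟩
    · have : η ∈ c.target := hη
      rw [ht] at this
      exact this t
    · have := hη'' t
      rwa [standardChart_symm_apply hs hf hη] at this
  have hincl : ContDiff ℝ ∞ (fun η : pathModel V => (η : C(I, V))) :=
    ContinuousLinearMap.contDiff (𝕜 := ℝ) (E := pathModel V) (F := C(I, V)) (pathModel V).subtypeL
  have hproj : ContDiff ℝ ∞ (pathProj V) :=
    ContinuousLinearMap.contDiff (𝕜 := ℝ) (E := C(I, V)) (F := pathModel V) _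
  have key := (hproj.comp_contDiffOn (contDiffOn_superposition hUo hFs)).comp
    hincl.contDiffOn hmaps
  refine key.congr fun η hη => ?_
  have h : superposition F η.1 = (c' (c.symm η)).1 := by
    ext t
    rw [superposition_apply hFs.continuousOn (hmaps η hη), hf' (c.symm η) hη.2,
      standardChart_symm_apply hs hf (show η ∈ c.target from hη.1)]
  have hm : superposition F η.1 ∈ pathModel V := by
    rw [h]
    exact (c' (c.symm η)).2
  change c' (c.symm η) = pathProj V (superposition F η.1)
  rw [pathProj_apply_of_mem hm]
  exact Subtype.ext h.symm

end

end PathCharts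

/-! ### Continuous families of local diffeomorphisms -/

section FamilyOn

variable {V V' V'' N N' N'' : Type*}
  [NormedAddCommGroup V] [NormedSpace ℝ V] [NormedAddCommGroup V'] [NormedSpace ℝ V']
  [NormedAddCommGroup V''] [NormedSpace ℝ V'']
  [TopologicalSpace N] [ChartedSpace V N] [TopologicalSpace N'] [ChartedSpace V' N']
  [TopologicalSpace N''] [ChartedSpace V'' N'']

variable (V V') in
/-- A family of diffeomorphisms between open subsets of two manifolds, indexed by `t ∈ I`, which
for `t ∈ J` depends continuously on `t` together with all its derivatives. -/
structure FamilyOn (J : Set I) (Φ : I → OpenPartialHomeomorph N N') : Prop where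
  isOpen_source : IsOpen {q : I × N | q.1 ∈ J ∧ q.2 ∈ (Φ q.1).source}
  isOpen_target : IsOpen {q : I × N' | q.1 ∈ J ∧ q.2 ∈ (Φ q.1).target}
  slice : SliceMDiffOn V V' (fun q : I × N => Φ q.1 q.2) {q | q.1 ∈ J ∧ q.2 ∈ (Φ q.1).source}
  slice_symm : SliceMDiffOn V' V (fun q : I × N' => (Φ q.1).symm q.2)
    {q | q.1 ∈ J ∧ q.2 ∈ (Φ q.1).target}

lemma isSmoothFamily_iff_familyOn {Φ : I → OpenPartialHomeomorph V N} :
    IsSmoothFamily Φ ↔ FamilyOn V V univ Φ := by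
  rw [isSmoothFamily_iff]
  constructor
  · rintro ⟨h1, h2, h3, h4⟩
    refine ⟨?_, ?_, ?_, ?_⟩ <;> simpa
  · rintro ⟨h1, h2, h3, h4⟩
    refine ⟨?_, ?_, ?_, ?_⟩ <;> simp_all

namespace FamilyOn

variable {J J' : Set I} {Φ Ψ : I → OpenPartialHomeomorph N N'}

lemma symm (h : FamilyOn V V' J Φ) : FamilyOn V' V J (fun t => (Φ t).symm) :=
  ⟨h.2, h.1, h.4, h.3⟩

lemma mono (h : FamilyOn V V' J Φ) (hJ : IsOpen J') (hJJ : J' ⊆ J) : FamilyOn V V' J' Φ := by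
  refine ⟨?_, ?_, h.3.mono fun q hq => ⟨hJJ hq.1, hq.2⟩, h.4.mono fun q hq => ⟨hJJ hq.1, hq.2⟩⟩
  · convert! h.1.inter (hJ.preimage continuous_fst) using 1
    ext q
    exact ⟨fun hq => ⟨⟨hJJ hq.1, hq.2⟩, hq.1⟩, fun hq => ⟨hq.2, hq.1.2⟩⟩
  · convert! h.2.inter (hJ.preimage continuous_fst) using 1
    ext q
    exact ⟨fun hq => ⟨⟨hJJ hq.1, hq.2⟩, hq.1⟩, fun hq => ⟨hq.2, hq.1.2⟩⟩

lemma isOpen_trans_source {Φ' : I → OpenPartialHomeomorph N' N''}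
    (h : FamilyOn V V' J Φ) (h' : FamilyOn V' V'' J Φ') :
    IsOpen {q : I × N | q.1 ∈ J ∧ q.2 ∈ ((Φ q.1).trans (Φ' q.1)).source} := by
  convert! (continuous_fst.continuousOn.prodMk h.3.1).isOpen_inter_preimage h.1 h'.1 using 1
  ext q
  exact ⟨fun hq => ⟨⟨hq.1, hq.2.1⟩, hq.1, hq.2.2⟩, fun hq => ⟨hq.1.1, hq.1.2, hq.2.2⟩⟩

lemma slice_trans {Φ' : I → OpenPartialHomeomorph N' N''}
    (h : FamilyOn V V' J Φ) (h' : FamilyOn V' V'' J Φ') :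
    SliceMDiffOn V V'' (fun q : I × N => ((Φ q.1).trans (Φ' q.1)) q.2)
      {q | q.1 ∈ J ∧ q.2 ∈ ((Φ q.1).trans (Φ' q.1)).source} :=
  h'.3.comp (h.3.mono fun _ hq => ⟨hq.1, hq.2.1⟩) (isOpen_trans_source h h')
    fun _ hq => ⟨hq.1, hq.2.2⟩

lemma trans {Φ' : I → OpenPartialHomeomorph N' N''}
    (h : FamilyOn V V' J Φ) (h' : FamilyOn V' V'' J Φ') :
    FamilyOn V V'' J (fun t => (Φ t).trans (Φ' t)) :=
  ⟨isOpen_trans_source h h', isOpen_trans_source h'.symm h.symm, slice_trans h h',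
    slice_trans h'.symm h.symm⟩

/-- All conditions are local in `t` and see only the domains and the values there. Families
assembled by case distinctions or by choice may thus be compared with a different continuous family
near each time. -/
lemma of_locally (h : ∀ t, ∃ J, IsOpen J ∧ t ∈ J ∧ ∃ Ψ : I → OpenPartialHomeomorph N N',
    FamilyOn V V' J Ψ ∧ ∀ t ∈ J, Ψ t ≈ Φ t) : FamilyOn V V' univ Φ := by
  have key : ∀ t, ∃ J, IsOpen J ∧ t ∈ J ∧ FamilyOn V V' J Φ := by
    intro t
    obtain ⟨J, hJ, ht, Ψ, hΨ, he⟩ := h t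
    have hs : {q : I × N | q.1 ∈ J ∧ q.2 ∈ (Φ q.1).source} =
        {q : I × N | q.1 ∈ J ∧ q.2 ∈ (Ψ q.1).source} := by
      ext q
      exact and_congr_right fun hq => by rw [(he q.1 hq).source_eq]
    have ht' : {q : I × N' | q.1 ∈ J ∧ q.2 ∈ (Φ q.1).target} =
        {q : I × N' | q.1 ∈ J ∧ q.2 ∈ (Ψ q.1).target} := by
      ext q
      exact and_congr_right fun hq => by rw [(he q.1 hq).target_eq]
    refine ⟨J, hJ, ht, ?_, ?_, ?_, ?_⟩
    · rw [hs]; exact hΨ.1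
    · rw [ht']; exact hΨ.2
    · rw [hs]; exact hΨ.3.congr hΨ.1 fun q hq => (he q.1 hq.1).eqOn hq.2
    · rw [ht']; exact hΨ.4.congr hΨ.2 fun q hq => (he q.1 hq.1).symm_eqOn_target hq.2
  refine ⟨isOpen_iff_forall_mem_open.2 fun q hq => ?_, isOpen_iff_forall_mem_open.2 fun q hq => ?_,
    SliceMDiffOn.of_locally fun q hq => ?_, SliceMDiffOn.of_locally fun q hq => ?_⟩ <;>
  obtain ⟨J, hJ, ht, hΦ⟩ := key q.1
  · exact ⟨_, fun p hp => ⟨trivial, hp.2⟩, hΦ.1, ht, hq.2⟩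
  · exact ⟨_, fun p hp => ⟨trivial, hp.2⟩, hΦ.2, ht, hq.2⟩
  · exact ⟨_, hΦ.1, ⟨ht, hq.2⟩, hΦ.3⟩
  · exact ⟨_, hΦ.2, ⟨ht, hq.2⟩, hΦ.4⟩

lemma const [IsManifold 𝓘(ℝ, V) ∞ N] [IsManifold 𝓘(ℝ, V') ∞ N'] (hJ : IsOpen J)
    {e : OpenPartialHomeomorph N N'} (h : ContMDiffOn 𝓘(ℝ, V) 𝓘(ℝ, V') ∞ e e.source)
    (h' : ContMDiffOn 𝓘(ℝ, V') 𝓘(ℝ, V) ∞ e.symm e.target) : FamilyOn V V' J (fun _ => e) :=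
  ⟨(hJ.preimage continuous_fst).inter (e.open_source.preimage continuous_snd),
    (hJ.preimage continuous_fst).inter (e.open_target.preimage continuous_snd),
    (sliceMDiffOn_const e.open_source h).mono fun _ hq => hq.2,
    (sliceMDiffOn_const e.open_target h').mono fun _ hq => hq.2⟩

lemma ofSet [IsManifold 𝓘(ℝ, V) ∞ N] (hJ : IsOpen J) {B : Set N} (hB : IsOpen B) :
    FamilyOn V V J (fun _ => OpenPartialHomeomorph.ofSet B hB) :=
  const hJ contMDiffOn_id contMDiffOn_id

lemma chart [IsManifold 𝓘(ℝ, V) ∞ N] (hJ : IsOpen J) {κ : OpenPartialHomeomorph N V}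
    (hκ : κ ∈ atlas V N) : FamilyOn V V J (fun _ => κ) :=
  const hJ (contMDiffOn_of_mem_maximalAtlas (IsManifold.subset_maximalAtlas hκ))
    (contMDiffOn_symm_of_mem_maximalAtlas (IsManifold.subset_maximalAtlas hκ))

lemma translate (hJ : IsOpen J) {a : I → V} (ha : Continuous a) :
    FamilyOn V V J (fun t => (Homeomorph.addRight (a t)).toOpenPartialHomeomorph) := by
  refine ⟨?_, ?_, ?_, ?_⟩
  · simpa using! hJ.preimage continuous_fst
  · simpa using! hJ.preimage continuous_fst
  · exact sliceMDiffOn_self_self_iff.2 (sliceSmoothOn_translate ha _)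
  · have h := sliceSmoothOn_translate ha.neg
      {q | q.1 ∈ J ∧ q.2 ∈ (Homeomorph.addRight (a q.1)).toOpenPartialHomeomorph.target}
    exact sliceMDiffOn_self_self_iff.2 h

end FamilyOn

end FamilyOn

/-! ### Smooth families along a path -/

section Existence

variable {V N : Type*} [NormedAddCommGroup V] [NormedSpace ℝ V]
  [TopologicalSpace N] [ChartedSpace V N] [IsManifold 𝓘(ℝ, V) ∞ N]

open Metric

/-- The family `Φ` is smooth, defined on a fixed ball, and centred at the path `γ` stopped at
time `s`. -/
structure IsFamilyAlong (γ : C(I, N)) (s : I) (r : ℝ) (Φ : I → OpenPartialHomeomorph V N) :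
    Prop where
  familyOn : FamilyOn V V univ Φ
  pos : 0 < r
  source_eq : ∀ t, (Φ t).source = ball 0 r
  apply_zero : ∀ t, Φ t 0 = γ (min t s)

/-- The path stopped at time `0` does not move, so one translated inverse chart at `γ 0` serves for
all `t`. -/
lemma exists_isFamilyAlong_zero (γ : C(I, N)) :
    ∃ r, ∃ Φ : I → OpenPartialHomeomorph V N, IsFamilyAlong γ 0 r Φ := by
  set κ := chartAt V (γ 0) with hκ
  have hκs : γ 0 ∈ κ.source := mem_chart_source _ _
  obtain ⟨r, hr, hb⟩ := Metric.isOpen_iff.1 κ.open_target _ (κ.map_source hκs)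
  refine ⟨r, fun t => (OpenPartialHomeomorph.ofSet (ball (0 : V) r) isOpen_ball).trans
    ((Homeomorph.addRight (κ (γ 0))).toOpenPartialHomeomorph.trans κ.symm), ?_, hr, ?_, ?_⟩
  · exact (FamilyOn.ofSet isOpen_univ isOpen_ball).trans
      ((FamilyOn.translate isOpen_univ continuous_const).trans
        (FamilyOn.chart isOpen_univ (chart_mem_atlas V _)).symm)
  · intro t
    ext v
    simp only [OpenPartialHomeomorph.trans_source, OpenPartialHomeomorph.ofSet_source,
      Homeomorph.toOpenPartialHomeomorph_source, OpenPartialHomeomorph.symm_source,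
      mem_inter_iff, mem_preimage, mem_univ, true_and, and_iff_left_iff_imp]
    intro hv
    refine hb ?_
    simpa using hv
  · intro t
    simp [hκs]

open Classical in
-- After time `s` the centre is moved along `γ` by a translation in the chart `κ`. The displacement
-- vanishes up to time `s`, so the moved family agrees there with the old one wherever both are
-- defined, and the two can be glued after shrinking the ball.
lemma IsFamilyAlong.extend {γ : C(I, N)} {s s' : I} {r : ℝ} {Φ : I → OpenPartialHomeomorph V N}
    (h : IsFamilyAlong γ s r Φ) (hss : s ≤ s') {κ : OpenPartialHomeomorph N V}
    (hκ : κ ∈ atlas V N) (hγ : ∀ t ∈ Icc s s', γ t ∈ κ.source) :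
    ∃ r', ∃ Φ' : I → OpenPartialHomeomorph V N, IsFamilyAlong γ s' r' Φ' := by
  obtain ⟨hΦ, hr, hsrc, h0⟩ := h
  have hcl : ∀ t, max s (min t s') ∈ Icc s s' :=
    fun t => ⟨le_max_left _ _, max_le hss (min_le_right _ _)⟩
  -- Clamping time to `[s, s']` keeps the argument of `κ` inside its domain and makes `a` continuous
  -- on all of `I`.
  set a : I → V := fun t => κ (γ (max s (min t s'))) - κ (γ s) with ha
  have hac : Continuous a := by
    refine Continuous.sub ?_ continuous_const
    exact κ.continuousOn.comp_continuous (by fun_prop) fun t => hγ _ (hcl t)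
  have ha0 : ∀ t ≤ s, a t = 0 := by
    intro t ht
    simp [ha, min_eq_left (ht.trans hss), max_eq_left ht]
  set shift : I → OpenPartialHomeomorph N N := fun t =>
    κ.trans ((Homeomorph.addRight (a t)).toOpenPartialHomeomorph.trans κ.symm) with hshift
  have hsh : FamilyOn V V univ shift :=
    (FamilyOn.chart isOpen_univ hκ).trans ((FamilyOn.translate isOpen_univ hac).trans
      (FamilyOn.chart isOpen_univ hκ).symm)
  have hΦs := hΦ.trans hsh
  have hcomp : Ici s ×ˢ {(0 : V)} ⊆ {q : I × V | q.1 ∈ univ ∧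
      q.2 ∈ ((Φ q.1).trans (shift q.1)).source} := by
    rintro ⟨t, v⟩ ⟨ht, hv⟩
    obtain rfl : v = 0 := hv
    have ht' : min t s = s := min_eq_right ht
    have hs : γ s ∈ κ.source := hγ s ⟨le_rfl, hss⟩
    refine ⟨trivial, ?_, ?_⟩
    · change (0 : V) ∈ (Φ t).source
      rw [hsrc]
      exact mem_ball_self hr
    · change Φ t 0 ∈ (shift t).source
      rw [h0, ht']
      refine ⟨hs, trivial, ?_⟩
      change κ (γ s) + (κ (γ (max s (min t s'))) - κ (γ s)) ∈ κ.target
      rw [add_sub_cancel]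
      exact κ.map_source (hγ _ (hcl t))
  -- The shifted family is defined at `0` for all `t ≥ s`. Compactness of `[s, 1]` extends this to
  -- an open `J` of times and a common neighbourhood `B` of `0`.
  obtain ⟨J, B, hJ, hB, hsJ, h0B, hJB⟩ := generalized_tube_lemma
    (isClosed_Ici (a := s)).isCompact isCompact_singleton hΦs.isOpen_source hcomp
  obtain ⟨ε, hε, hεB⟩ := Metric.isOpen_iff.1 hB 0 (h0B rfl)
  -- The bound `ε` serves the shifted family for `t ∈ J`, and `r` serves the original one elsewhere.
  set ρ := min ε r with hρ
  have hρ0 : 0 < ρ := lt_min hε hr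
  set cut := OpenPartialHomeomorph.ofSet (ball (0 : V) ρ) isOpen_ball with hcut
  have hcutF : ∀ {J : Set I}, IsOpen J → FamilyOn V V J (fun _ => cut) :=
    fun hJ => FamilyOn.ofSet hJ isOpen_ball
  have hΦ1 : ∀ t, (cut.trans (Φ t)).source = ball 0 ρ := by
    intro t
    ext v
    refine ⟨fun hv => hv.1, fun hv => ⟨hv, ?_⟩⟩
    rw [hsrc]
    exact ball_subset_ball (min_le_right _ _) hv
  have hΦ2 : ∀ t ∈ J, (cut.trans ((Φ t).trans (shift t))).source = ball 0 ρ := by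
    intro t ht
    ext v
    refine ⟨fun hv => hv.1, fun hv => ⟨hv, ?_⟩⟩
    exact (hJB (show (t, v) ∈ J ×ˢ B from
      ⟨ht, hεB (ball_subset_ball (min_le_left _ _) hv)⟩)).2
  have hshift0 : ∀ t ≤ s, ∀ p ∈ κ.source, shift t p = p := by
    intro t ht p hp
    change κ.symm (κ p + a t) = p
    rw [ha0 t ht, add_zero, κ.left_inv hp]
  set Φ' : I → OpenPartialHomeomorph V N := fun t =>
    if t ∈ J then cut.trans ((Φ t).trans (shift t)) else cut.trans (Φ t) with hΦ'
  have hsrc' : ∀ t, (Φ' t).source = ball 0 ρ := by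
    intro t
    by_cases ht : t ∈ J
    · simp only [hΦ', ht, if_true, hΦ2]
    · simp only [hΦ', ht, if_false, hΦ1]
  refine ⟨ρ, Φ', FamilyOn.of_locally fun t => ?_, hρ0, hsrc', fun t => ?_⟩
  · by_cases ht : t ∈ J
    · refine ⟨J, hJ, ht, _, ((hcutF isOpen_univ).trans hΦs).mono hJ (subset_univ _),
        fun t' ht' => ?_⟩
      simp only [hΦ', ht', if_true]
      exact Setoid.refl _
    -- Since `J` contains all times from `s` on, the remaining times precede `s`, where the shift is
    -- the identity and both branches coincide.
    · have hts : t < s := not_le.1 fun hst => ht (hsJ hst)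
      refine ⟨Iio s, isOpen_Iio, hts, _, ((hcutF isOpen_univ).trans hΦ).mono isOpen_Iio
        (subset_univ _), fun t' ht' => ⟨?_, fun v hv => ?_⟩⟩
      · exact (hΦ1 t').trans (hsrc' t').symm
      · by_cases ht'J : t' ∈ J
        · simp only [hΦ', ht'J, if_true]
          have hv' : v ∈ (cut.trans ((Φ t').trans (shift t'))).source := by
            rw [hΦ2 t' ht'J, ← hΦ1 t']
            exact hv
          exact (hshift0 t' (le_of_lt ht') _ hv'.2.2.1).symm
        · simp only [hΦ', ht'J, if_false]
  · by_cases ht : t ∈ J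
    · have h0s : (0 : V) ∈ (cut.trans ((Φ t).trans (shift t))).source := by
        rw [hΦ2 t ht]
        exact mem_ball_self hρ0
      have hmem : Φ t 0 ∈ κ.source := h0s.2.2.1
      simp only [hΦ', ht, if_true]
      change shift t (Φ t 0) = _
      rcases le_total t s with hts | hts
      · rw [hshift0 t hts _ hmem, h0, min_eq_left hts, min_eq_left (hts.trans hss)]
      · rw [h0, min_eq_right hts]
        change κ.symm (κ (γ s) + (κ (γ (max s (min t s'))) - κ (γ s))) = _
        rw [add_sub_cancel, κ.left_inv (hγ _ (hcl t)), max_eq_right (le_min hts hss)]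
    · have hts : t < s := not_le.1 fun hst => ht (hsJ hst)
      simp only [hΦ', ht, if_false]
      change Φ t 0 = _
      rw [h0, min_eq_left hts.le, min_eq_left (hts.le.trans hss)]

/-- By a Lebesgue number argument `γ` runs through one chart on each interval of a finite
subdivision. Extending over these intervals in turn reaches time `1`, where stopping no longer
changes the path. -/
theorem exists_isFamilyAlong (γ : C(I, N)) :
    ∃ r, ∃ Φ : I → OpenPartialHomeomorph V N, IsFamilyAlong γ 1 r Φ := by
  obtain ⟨u, u0, hu, ⟨m, hm⟩, hsub⟩ := exists_monotone_Icc_subset_open_cover_unitInterval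
    (c := fun p : N => γ ⁻¹' (chartAt V p).source)
    (fun p => (chartAt V p).open_source.preimage γ.continuous)
    (fun t _ => mem_iUnion.2 ⟨γ t, mem_chart_source V (γ t)⟩)
  have key : ∀ k, ∃ r, ∃ Φ : I → OpenPartialHomeomorph V N, IsFamilyAlong γ (u k) r Φ := by
    intro k
    induction k with
    | zero => rw [u0]; exact exists_isFamilyAlong_zero γ
    | succ k ih =>
      obtain ⟨r, Φ, h⟩ := ih
      obtain ⟨p, hp⟩ := hsub k
      exact h.extend (hu k.le_succ) (chart_mem_atlas V p) fun t ht => hp ht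
  simpa [hm m le_rfl] using key m

/-- The standard charts of the space of paths from `y` to `z` form an atlas. -/
@[reducible] noncomputable def pathChartedSpace (y z : N) : ChartedSpace (pathModel V) (Path y z) :=
  have key : ∀ γ : Path y z, ∃ c : OpenPartialHomeomorph (Path y z) (pathModel V),
      IsStandardPathChart c ∧ γ ∈ c.source := fun γ => by
    obtain ⟨r, Φ, h⟩ := exists_isFamilyAlong (V := V) (γ : C(I, N))
    have hz : ∀ t, 0 ∈ (Φ t).source := fun t => by
      rw [h.source_eq]
      exact mem_ball_self h.pos
    have hγ : ∀ t, Φ t 0 = γ t := fun t => by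
      simpa [min_eq_left (le_one' (t := t))] using h.apply_zero t
    refine ⟨familyChart (isSmoothFamily_iff_familyOn.2 h.familyOn) ⟨hz 0, by simp [hγ]⟩
      ⟨hz 1, by simp [hγ]⟩ γ, isStandardPathChart_familyChart .., fun t => ?_⟩
    rw [← hγ]
    exact (Φ t).map_source (hz t)
  { atlas := {c | IsStandardPathChart c}
    chartAt γ := (key γ).choose
    mem_chart_source γ := (key γ).choose_spec.2
    chart_mem_atlas γ := (key γ).choose_spec.1 }

theorem isStandardPathManifold_pathChartedSpace (y z : N) :
    let _ := pathChartedSpace (V := V) y z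
    IsStandardPathManifold (V := V) y z := by
  let _ := pathChartedSpace (V := V) y z
  refine ⟨rfl, isManifold_of_contDiffOn _ _ _ fun c c' hc hc' => ?_⟩
  simpa using contDiffOn_standardChart_transition hc hc'

end Existence

/-! ### Local diffeomorphisms -/

section LocalDiffeo

variable {V W Z : Type*} [NormedAddCommGroup V] [NormedSpace ℝ V]
  [NormedAddCommGroup W] [NormedSpace ℝ W] [NormedAddCommGroup Z] [NormedSpace ℝ Z]
  {H : Type*} [TopologicalSpace H] {J : ModelWithCorners ℝ Z H}
  {X Y Q : Type*} [TopologicalSpace X] [TopologicalSpace Y] [TopologicalSpace Q]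

lemma isLocalDiffeomorphAt_of_openPartialHomeomorph [ChartedSpace V X] [ChartedSpace W Y]
    {f : X → Y} {x : X} {e : OpenPartialHomeomorph X Y} (hx : x ∈ e.source)
    (h : ContMDiffOn 𝓘(ℝ, V) 𝓘(ℝ, W) ∞ e e.source)
    (h' : ContMDiffOn 𝓘(ℝ, W) 𝓘(ℝ, V) ∞ e.symm e.target) (hf : EqOn f e e.source) :
    IsLocalDiffeomorphAt 𝓘(ℝ, V) 𝓘(ℝ, W) ∞ f x :=
  ⟨⟨e.toPartialEquiv, e.open_source, e.open_target, h, h'⟩, hx, hf⟩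

lemma contMDiff_of_comp_isLocalDiffeomorph [ChartedSpace H Q] [ChartedSpace V X] [ChartedSpace W Y]
    {g : X → Y} (hg : IsLocalDiffeomorph 𝓘(ℝ, V) 𝓘(ℝ, W) ∞ g) {f : Q → X} (hf : Continuous f)
    (h : ContMDiff J 𝓘(ℝ, W) ∞ (fun q => g (f q))) : ContMDiff J 𝓘(ℝ, V) ∞ f := by
  intro q
  obtain ⟨Ψ, hq, hΨ⟩ := hg (f q)
  have hgq : g (f q) ∈ Ψ.target := by
    rw [hΨ hq]
    exact Ψ.map_source hq
  have h1 : ContMDiffAt 𝓘(ℝ, W) 𝓘(ℝ, V) ∞ Ψ.invFun (g (f q)) :=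
    Ψ.contMDiffOn_invFun.contMDiffAt (Ψ.open_target.mem_nhds hgq)
  refine (h1.comp q (h q)).congr_of_eventuallyEq ?_
  filter_upwards [hf.continuousAt.eventually (Ψ.open_source.mem_nhds hq)] with q' hq'
  change f q' = Ψ.invFun (g (f q'))
  rw [hΨ hq']
  exact (Ψ.left_inv hq').symm

lemma isLocalDiffeomorph_of_comp [ChartedSpace V X] [ChartedSpace W Y] [ChartedSpace Z Q]
    {f : X → Y} {g : Y → Q} (hf : Continuous f) (hg : IsLocalDiffeomorph 𝓘(ℝ, W) 𝓘(ℝ, Z) ∞ g)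
    (h : IsLocalDiffeomorph 𝓘(ℝ, V) 𝓘(ℝ, Z) ∞ (fun x => g (f x))) :
    IsLocalDiffeomorph 𝓘(ℝ, V) 𝓘(ℝ, W) ∞ f := by
  intro x
  obtain ⟨Φ, hx, hΦ⟩ := h x
  obtain ⟨Ψ, hy, hΨ⟩ := hg (f x)
  have hO : IsOpen (Φ.source ∩ f ⁻¹' Ψ.source) := Φ.open_source.inter (Ψ.open_source.preimage hf)
  -- Restriction to the open set on which both local branches apply; there `f` is the inverse branch
  -- of `g` after that of the composite.
  let C : PartialDiffeomorph 𝓘(ℝ, V) 𝓘(ℝ, V) X X ∞ :=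
    ⟨PartialEquiv.ofSet (Φ.source ∩ f ⁻¹' Ψ.source), hO, hO, contMDiffOn_id, contMDiffOn_id⟩
  have hval : ∀ x' ∈ Φ.source ∩ f ⁻¹' Ψ.source, Φ.toFun x' = Ψ.toFun (f x') :=
    fun x' hx' => (hΦ hx'.1).symm.trans (hΨ hx'.2)
  refine ⟨(C.trans Φ).trans Ψ.symm, ⟨⟨⟨hx, hy⟩, hx⟩, ?_⟩, fun x' hx' => ?_⟩
  · change Φ.toFun x ∈ Ψ.target
    rw [hval x ⟨hx, hy⟩]
    exact Ψ.map_source hy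
  · have hx'' : x' ∈ Φ.source ∩ f ⁻¹' Ψ.source := hx'.1.1
    change f x' = Ψ.invFun (Φ.toFun x')
    rw [hval x' hx'']
    exact (Ψ.left_inv hx''.2).symm

/-- The manifold structure pulled back along a local homeomorphism. -/
@[reducible] noncomputable def pullbackChartedSpace [ChartedSpace V Y] {f : X → Y}
    (hf : IsLocalHomeomorph f) : ChartedSpace V X where
  atlas := {e | ∃ s : OpenPartialHomeomorph X Y, f = s ∧ ∃ κ ∈ atlas V Y, e = s.trans κ}
  chartAt x := (hf x).choose.trans (chartAt V (f x))
  mem_chart_source x := by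
    refine ⟨(hf x).choose_spec.1, ?_⟩
    change (hf x).choose x ∈ (chartAt V (f x)).source
    rw [← (hf x).choose_spec.2]
    exact mem_chart_source V (f x)
  chart_mem_atlas x := ⟨_, (hf x).choose_spec.2, _, chart_mem_atlas V _, rfl⟩

/-- The local branches `s` and `s'` are both `f`, so they cancel in a transition map. What remains
is a restriction of a transition map of `Y`. -/
lemma isManifold_pullbackChartedSpace [ChartedSpace V Y] [IsManifold 𝓘(ℝ, V) ∞ Y] {f : X → Y}
    (hf : IsLocalHomeomorph f) :
    let _ := pullbackChartedSpace (V := V) hf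
    IsManifold 𝓘(ℝ, V) ∞ X := by
  intro _
  refine isManifold_of_contDiffOn _ _ _ ?_
  rintro _ _ ⟨s, hs, κ, hκ, rfl⟩ ⟨s', hs', κ', hκ', rfl⟩
  have hval : ∀ v ∈ ((s.trans κ).symm.trans (s'.trans κ')).source,
      s' (s.symm (κ.symm v)) = κ.symm v := by
    intro v hv
    rw [← hs', hs]
    exact s.right_inv hv.1.2
  have h1 : ContMDiffOn 𝓘(ℝ, V) 𝓘(ℝ, V) ∞ κ.symm κ.target :=
    contMDiffOn_symm_of_mem_maximalAtlas (IsManifold.subset_maximalAtlas hκ)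
  have h2 : ContMDiffOn 𝓘(ℝ, V) 𝓘(ℝ, V) ∞ κ' κ'.source :=
    contMDiffOn_of_mem_maximalAtlas (IsManifold.subset_maximalAtlas hκ')
  have h : ContDiffOn ℝ ∞ (κ' ∘ κ.symm) ((s.trans κ).symm.trans (s'.trans κ')).source := by
    rw [← contMDiffOn_iff_contDiffOn]
    refine h2.comp (h1.mono fun v hv => hv.1.1) fun v hv => ?_
    have h3 : s' (s.symm (κ.symm v)) ∈ κ'.source := hv.2.2
    rwa [hval v hv] at h3
  have h' : ContDiffOn ℝ ∞ ((s.trans κ).symm.trans (s'.trans κ'))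
      ((s.trans κ).symm.trans (s'.trans κ')).source :=
    h.congr fun v hv => congrArg κ' (hval v hv)
  simpa using h'

lemma isLocalDiffeomorph_pullbackChartedSpace [ChartedSpace V Y] [IsManifold 𝓘(ℝ, V) ∞ Y]
    {f : X → Y} (hf : IsLocalHomeomorph f) :
    let _ := pullbackChartedSpace (V := V) hf
    IsLocalDiffeomorph 𝓘(ℝ, V) 𝓘(ℝ, V) ∞ f := by
  intro _ x
  have _ := isManifold_pullbackChartedSpace (V := V) hf
  obtain ⟨s, hx, hs⟩ := hf x
  set κ := chartAt V (f x) with hκ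
  have hκs : s x ∈ κ.source := by
    rw [← hs]
    exact mem_chart_source V (f x)
  have he : s.trans κ ∈ atlas V X := ⟨s, hs, κ, chart_mem_atlas V _, rfl⟩
  have e1 : ContMDiffOn 𝓘(ℝ, V) 𝓘(ℝ, V) ∞ (s.trans κ) (s.trans κ).source :=
    contMDiffOn_of_mem_maximalAtlas (IsManifold.subset_maximalAtlas he)
  have e2 : ContMDiffOn 𝓘(ℝ, V) 𝓘(ℝ, V) ∞ (s.trans κ).symm (s.trans κ).target :=
    contMDiffOn_symm_of_mem_maximalAtlas (IsManifold.subset_maximalAtlas he)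
  have k1 : ContMDiffOn 𝓘(ℝ, V) 𝓘(ℝ, V) ∞ κ κ.source :=
    contMDiffOn_of_mem_maximalAtlas (IsManifold.subset_maximalAtlas (chart_mem_atlas V _))
  have k2 : ContMDiffOn 𝓘(ℝ, V) 𝓘(ℝ, V) ∞ κ.symm κ.target :=
    contMDiffOn_symm_of_mem_maximalAtlas (IsManifold.subset_maximalAtlas (chart_mem_atlas V _))
  refine isLocalDiffeomorphAt_of_openPartialHomeomorph (e := (s.trans κ).trans κ.symm)
    ⟨⟨hx, hκs⟩, ?_⟩ ?_ ?_ fun x' hx' => ?_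
  · exact κ.map_source hκs
  · exact k2.comp (e1.mono fun x' hx' => hx'.1) fun x' hx' => hx'.2
  · exact e2.comp (k1.mono fun y hy => hy.1) fun y hy => hy.2
  · change f x' = κ.symm (κ (s x'))
    rw [hs]
    exact (κ.left_inv hx'.1.2).symm

end LocalDiffeo

/-! ### Pushing paths forward along a local diffeomorphism -/

section Push

variable {V N M : Type*} [NormedAddCommGroup V] [NormedSpace ℝ V]
  [TopologicalSpace N] [ChartedSpace V N] [IsManifold 𝓘(ℝ, V) ∞ N]
  [TopologicalSpace M] [ChartedSpace V M] [IsManifold 𝓘(ℝ, V) ∞ M]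

open Metric

omit [IsManifold 𝓘(ℝ, V) ∞ N] [IsManifold 𝓘(ℝ, V) ∞ M] in
-- Near each time one diffeomorphic branch of `f` covers a small image ball. Compactness of `I`
-- makes the radius uniform, while the branch may still vary with time.
lemma IsFamilyAlong.exists_shrink {γ : C(I, N)} {r : ℝ} {Φ : I → OpenPartialHomeomorph V N}
    (h : IsFamilyAlong γ 1 r Φ) {f : N → M} (hf : IsLocalDiffeomorph 𝓘(ℝ, V) 𝓘(ℝ, V) ∞ f) :
    ∃ ρ > 0, ρ ≤ r ∧ ∀ t, ∃ J, IsOpen J ∧ t ∈ J ∧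
      ∃ s : PartialDiffeomorph 𝓘(ℝ, V) 𝓘(ℝ, V) N M ∞, EqOn f s.toFun s.source ∧
        ∀ t' ∈ J, ∀ v ∈ ball (0 : V) ρ, Φ t' v ∈ s.source := by
  have key := (isCompact_univ (X := I)).induction_on (p := fun K => ∃ ρ > 0, ρ ≤ r ∧ ∀ t ∈ K,
    ∃ J, IsOpen J ∧ t ∈ J ∧ ∃ s : PartialDiffeomorph 𝓘(ℝ, V) 𝓘(ℝ, V) N M ∞,
      EqOn f s.toFun s.source ∧ ∀ t' ∈ J, ∀ v ∈ ball (0 : V) ρ, Φ t' v ∈ s.source)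
    ⟨r, h.pos, le_rfl, by simp⟩ ?_ ?_ ?_
  · simpa using key
  · rintro K K' hK ⟨ρ, h0, hr, hρ⟩
    exact ⟨ρ, h0, hr, fun t ht => hρ t (hK ht)⟩
  · rintro K K' ⟨ρ, h0, hr, hρ⟩ ⟨ρ', h0', -, hρ'⟩
    refine ⟨min ρ ρ', lt_min h0 h0', (min_le_left _ _).trans hr, fun t ht => ?_⟩
    rcases ht with ht | ht
    · obtain ⟨J, hJ, htJ, s, hs, hs'⟩ := hρ t ht
      exact ⟨J, hJ, htJ, s, hs, fun t' ht' v hv =>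
        hs' t' ht' v (ball_subset_ball (min_le_left _ _) hv)⟩
    · obtain ⟨J, hJ, htJ, s, hs, hs'⟩ := hρ' t ht
      exact ⟨J, hJ, htJ, s, hs, fun t' ht' v hv =>
        hs' t' ht' v (ball_subset_ball (min_le_right _ _) hv)⟩
  · intro t _
    obtain ⟨s, hs, hfs⟩ := hf (Φ t 0)
    have hz : (0 : V) ∈ (Φ t).source := by
      rw [h.source_eq]
      exact mem_ball_self h.pos
    have hO : IsOpen ({q : I × V | q.1 ∈ univ ∧ q.2 ∈ (Φ q.1).source} ∩
        (fun q : I × V => Φ q.1 q.2) ⁻¹' s.source) :=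
      h.familyOn.slice.continuousOn.isOpen_inter_preimage h.familyOn.isOpen_source s.open_source
    obtain ⟨J, hJ, B, hB, hJB⟩ := mem_nhds_prod_iff.1 (hO.mem_nhds (x := (t, 0))
      ⟨⟨trivial, hz⟩, hs⟩)
    obtain ⟨J', hJ', hJo, htJ⟩ := _root_.mem_nhds_iff.1 hJ
    obtain ⟨ε, hε, hεB⟩ := Metric.mem_nhds_iff.1 hB
    refine ⟨J', mem_nhdsWithin_of_mem_nhds (hJo.mem_nhds htJ), min ε r, lt_min hε h.pos,
      min_le_right _ _, fun t' ht' => ⟨J', hJo, ht', s, hfs, fun t'' ht'' v hv => ?_⟩⟩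
    exact (hJB (show (t'', v) ∈ J ×ˢ B from
      ⟨hJ' ht'', hεB (ball_subset_ball (min_le_left _ _) hv)⟩)).2

variable (V) in
lemma exists_families_push (γ : C(I, N)) {f : N → M}
    (hf : IsLocalDiffeomorph 𝓘(ℝ, V) 𝓘(ℝ, V) ∞ f) :
    ∃ ρ > 0, ∃ (Φ : I → OpenPartialHomeomorph V N) (Ψ : I → OpenPartialHomeomorph V M),
      IsSmoothFamily Φ ∧ IsSmoothFamily Ψ ∧ (∀ t, (Φ t).source = ball 0 ρ) ∧
      (∀ t, (Ψ t).source = ball 0 ρ) ∧ (∀ t, Φ t 0 = γ t) ∧ ∀ t v, v ∈ ball (0 : V) ρ →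
        Ψ t v = f (Φ t v) := by
  obtain ⟨r, Φ, h⟩ := exists_isFamilyAlong (V := V) γ
  obtain ⟨ρ, hρ, hρr, hloc⟩ := h.exists_shrink hf
  have hS : ∀ t, ∃ s : PartialDiffeomorph 𝓘(ℝ, V) 𝓘(ℝ, V) N M ∞, EqOn f s.toFun s.source ∧
      ∀ v ∈ ball (0 : V) ρ, Φ t v ∈ s.source := by
    intro t
    obtain ⟨J, -, htJ, s, hs, hs'⟩ := hloc t
    exact ⟨s, hs, hs' t htJ⟩
  -- The chosen branches need not vary continuously with `t`. This is harmless: on the relevant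
  -- images each equals `f`, so near any time they can be replaced by one fixed branch.
  choose S hS1 hS2 using hS
  set cut := OpenPartialHomeomorph.ofSet (ball (0 : V) ρ) isOpen_ball with hcut
  have hcutΦ : FamilyOn V V univ (fun t => cut.trans (Φ t)) :=
    (FamilyOn.ofSet isOpen_univ isOpen_ball).trans h.familyOn
  have hsrc : ∀ t, (cut.trans (Φ t)).source = ball 0 ρ := by
    intro t
    ext v
    refine ⟨fun hv => hv.1, fun hv => ⟨hv, ?_⟩⟩
    rw [h.source_eq]
    exact ball_subset_ball hρr hv
  have hsrc' : ∀ t (s : PartialDiffeomorph 𝓘(ℝ, V) 𝓘(ℝ, V) N M ∞),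
      (∀ v ∈ ball (0 : V) ρ, Φ t v ∈ s.source) →
      ((cut.trans (Φ t)).trans s.toOpenPartialHomeomorph).source = ball 0 ρ := by
    intro t s hs
    ext v
    refine ⟨fun hv => hv.1.1, fun hv => ⟨?_, hs v hv⟩⟩
    exact (hsrc t).ge hv
  refine ⟨ρ, hρ, fun t => cut.trans (Φ t),
    fun t => (cut.trans (Φ t)).trans (S t).toOpenPartialHomeomorph,
    isSmoothFamily_iff_familyOn.2 hcutΦ,
    isSmoothFamily_iff_familyOn.2 (FamilyOn.of_locally fun t => ?_), hsrc,
    fun t => hsrc' t _ (hS2 t), fun t => ?_, fun t v hv => (hS1 t (hS2 t v hv)).symm⟩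
  · obtain ⟨J, hJ, htJ, s, hs, hs'⟩ := hloc t
    refine ⟨J, hJ, htJ, _, (hcutΦ.mono hJ (subset_univ _)).trans
      (FamilyOn.const hJ (e := s.toOpenPartialHomeomorph) s.contMDiffOn_toFun
        s.contMDiffOn_invFun), fun t' ht' => ⟨?_, fun v hv => ?_⟩⟩
    · exact (hsrc' t' s (hs' t' ht')).trans (hsrc' t' _ (hS2 t')).symm
    · have hv' : v ∈ ball (0 : V) ρ := hv.1.1
      exact (hs (hs' t' ht' v hv')).symm.trans (hS1 t' (hS2 t' v hv'))
  · change Φ t 0 = γ t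
    simpa [min_eq_left (le_one' (t := t))] using h.apply_zero t

/-- Pushing a path forward. -/
def pushPath {f : N → M} (hf : Continuous f) {y z : N} {y' z' : M} (hy : f y = y') (hz : f z = z')
    (γ : Path y z) : Path y' z' := (γ.map hf).cast hy.symm hz.symm

/-- With charts given by families `Φ` and `f ∘ Φ` on the same ball, a path and its image have the
same coordinates. So the map is the identity between equal chart targets. -/
theorem isLocalDiffeomorph_pushPath {f : N → M}
    (hf : IsLocalDiffeomorph 𝓘(ℝ, V) 𝓘(ℝ, V) ∞ f) (hfc : Continuous f) {y z : N} {y' z' : M}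
    (hy : f y = y') (hz : f z = z') :
    let _ := pathChartedSpace (V := V) y z
    let _ := pathChartedSpace (V := V) y' z'
    IsLocalDiffeomorph 𝓘(ℝ, pathModel V) 𝓘(ℝ, pathModel V) ∞ (pushPath hfc hy hz) := by
  intro _ _ γ
  have _ := (isStandardPathManifold_pathChartedSpace (V := V) y z).isManifold
  have _ := (isStandardPathManifold_pathChartedSpace (V := V) y' z').isManifold
  obtain ⟨ρ, hρ, Φ, Ψ, hΦ, hΨ, hΦs, hΨs, hΦγ, hΨΦ⟩ := exists_families_push V (γ : C(I, N)) hf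
  have hb : (0 : V) ∈ ball (0 : V) ρ := mem_ball_self hρ
  have hb1 : ∀ t, (0 : V) ∈ (Φ t).source := fun t => by rw [hΦs]; exact hb
  have hb2 : ∀ t, (0 : V) ∈ (Ψ t).source := fun t => by rw [hΨs]; exact hb
  set c := familyChart hΦ ⟨hb1 0, by simp [hΦγ]⟩ ⟨hb1 1, by simp [hΦγ]⟩ γ with hc
  set c' := familyChart hΨ (y := y') (z := z') ⟨hb2 0, by simp [hΨΦ 0 0 hb, hΦγ, hy]⟩
    ⟨hb2 1, by simp [hΨΦ 1 0 hb, hΦγ, hz]⟩ (pushPath hfc hy hz γ) with hc'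
  have hcs : IsStandardPathChart c := isStandardPathChart_familyChart ..
  have hcs' : IsStandardPathChart c' := isStandardPathChart_familyChart ..
  have htt : c.target = c'.target := by
    ext η
    simp only [hc, hc', familyChart_target, hΦs, hΨs]
  have h1 : ContMDiffOn 𝓘(ℝ, pathModel V) 𝓘(ℝ, pathModel V) ∞ c c.source :=
    contMDiffOn_of_mem_maximalAtlas (IsManifold.subset_maximalAtlas hcs)
  have h2 : ContMDiffOn 𝓘(ℝ, pathModel V) 𝓘(ℝ, pathModel V) ∞ c.symm c.target :=
    contMDiffOn_symm_of_mem_maximalAtlas (IsManifold.subset_maximalAtlas hcs)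
  have h3 : ContMDiffOn 𝓘(ℝ, pathModel V) 𝓘(ℝ, pathModel V) ∞ c' c'.source :=
    contMDiffOn_of_mem_maximalAtlas (IsManifold.subset_maximalAtlas hcs')
  have h4 : ContMDiffOn 𝓘(ℝ, pathModel V) 𝓘(ℝ, pathModel V) ∞ c'.symm c'.target :=
    contMDiffOn_symm_of_mem_maximalAtlas (IsManifold.subset_maximalAtlas hcs')
  have hγ : γ ∈ c.source := fun t => by
    have := (Φ t).map_source (hb1 t)
    rwa [hΦγ] at this
  refine isLocalDiffeomorphAt_of_openPartialHomeomorph (e := c.trans c'.symm) ⟨hγ, ?_⟩ ?_ ?_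
    fun γ' hγ' => ?_
  · change c γ ∈ c'.target
    rw [← htt]
    exact c.map_source hγ
  · exact h4.comp (h1.mono fun x' hx' => hx'.1) fun x' hx' => hx'.2
  · exact h2.comp (h3.mono fun y hy => hy.1) fun y hy => hy.2
  · have hs : γ' ∈ c.source := hγ'.1
    have hη : c γ' ∈ c.target := c.map_source hs
    have hη' : c γ' ∈ c'.target := htt ▸ hη
    ext t
    change f (γ' t) = c'.symm (c γ') t
    rw [standardChart_symm_apply (familyChart_source ..)
      (fun γ hγ t => familyChart_apply _ _ _ _ hγ t) hη', hΨΦ _ _ (by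
        have := hη t
        rwa [hΦs] at this)]
    congr 1
    have h5 := standardChart_symm_apply (familyChart_source ..)
      (fun γ hγ t => familyChart_apply _ _ _ _ hγ t) hη t
    rwa [c.left_inv hs] at h5

end Push

/-! ### Path components of path spaces -/

section PathComponents

variable {Y : Type*} [TopologicalSpace Y] {x y : Y}

lemma continuous_path_iff {Z : Type*} [TopologicalSpace Z] {f : Z → Path x y} :
    Continuous f ↔ Continuous fun z => (f z : C(I, Y)) :=
  continuous_induced_rng

lemma continuous_path_of_uncurry {Z : Type*} [TopologicalSpace Z] {f : Z → Path x y}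
    (hf : Continuous fun p : Z × I => f p.1 p.2) : Continuous f :=
  continuous_path_iff.2 (ContinuousMap.continuous_of_continuous_uncurry _ hf)

lemma continuous_pushPath {X : Type*} [TopologicalSpace X] {f : X → Y} (hf : Continuous f)
    {a b : X} (ha : f a = x) (hb : f b = y) :
    Continuous (pushPath hf ha hb) := by
  refine continuous_path_of_uncurry ?_
  change Continuous fun p : Path a b × I => f (p.1 p.2)
  fun_prop

/-- Currying turns a path in `Path x y` into a homotopy. It is automatically relative to the end
points, since these are built into the type. -/
theorem mem_pathComponent_iff_homotopic {η γ : Path x y} :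
    γ ∈ pathComponent η ↔ γ.Homotopic η := by
  constructor
  · rintro ⟨Γ⟩
    refine Path.Homotopic.symm ⟨?_⟩
    exact
      { toFun p := Γ p.1 p.2
        continuous_toFun := by fun_prop
        map_zero_left t := by simp
        map_one_left t := by simp
        prop' t s hs := by
          rcases hs with rfl | rfl <;> simp }
  · intro h
    obtain ⟨F⟩ := h.symm
    refine ⟨⟨⟨F.eval, ?_⟩, F.eval_zero, F.eval_one⟩⟩
    refine continuous_path_of_uncurry ?_
    exact F.toContinuousMap.continuous

end PathComponents

/-! ### Lifts of loops -/

section Lifts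

variable {X Y : Type*} [TopologicalSpace X] [TopologicalSpace Y] {π : X → Y}
  (hπ : IsCoveringMap π) {x : Y}

lemma liftAt_zero (γ : Path x x) (e : π ⁻¹' {x}) : liftAt hπ γ e 0 = e := hπ.liftPath_zero _ _ _

lemma proj_liftAt (γ : Path x x) (e : π ⁻¹' {x}) (t : I) : π (liftAt hπ γ e t) = γ t :=
  congrFun (hπ.liftPath_lifts _ _ _) t

lemma eq_liftAt {γ : Path x x} {e : π ⁻¹' {x}} {Γ : C(I, X)} (h : ∀ t, π (Γ t) = γ t)
    (h0 : Γ 0 = e) : Γ = liftAt hπ γ e :=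
  (hπ.eq_liftPath_iff' _).2 ⟨funext h, h0⟩

/-- The end point of the lift of a loop, as an element of the fibre. -/
noncomputable def endAt (γ : Path x x) (e : π ⁻¹' {x}) : π ⁻¹' {x} :=
  ⟨liftAt hπ γ e 1, (proj_liftAt hπ γ e 1).trans γ.target⟩

/-- Lifts are jointly continuous in time and loop: this propagates from the constant initial value
`e` along the continuous slices. Currying gives the compact-open statement. -/
lemma continuous_liftAt (e : π ⁻¹' {x}) : Continuous fun γ : Path x x => liftAt hπ γ e := by
  have h : Continuous fun p : I × Path x x => liftAt hπ p.2 e p.1 := by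
    refine hπ.isLocalHomeomorph.continuous_lift hπ.isSeparatedMap
      (⟨fun p : I × Path x x => p.2 p.1, by fun_prop⟩ : C(I × Path x x, Y)) ?_ ?_ ?_
    · ext p
      exact proj_liftAt hπ p.2 e p.1
    · simp only [liftAt_zero]
      exact continuous_const
    · exact fun γ => (liftAt hπ γ e).continuous
  exact ContinuousMap.continuous_of_continuous_uncurry _ (h.comp continuous_swap)

include hπ in
lemma discreteTopology_fibre : DiscreteTopology (π ⁻¹' {x}) := (hπ x).1

lemma continuous_endAt (e : π ⁻¹' {x}) : Continuous fun γ : Path x x => endAt hπ γ e :=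
  ((continuous_eval_const (1 : I)).comp (continuous_liftAt hπ e)).subtype_mk _

lemma liftAt_pushPath {e e' : π ⁻¹' {x}} (Γ : Path e.1 e'.1) :
    liftAt hπ (pushPath hπ.continuous e.2 e'.2 Γ) e = (Γ : C(I, X)) :=
  (eq_liftAt hπ (fun _ => rfl) Γ.source).symm

lemma endAt_pushPath {e e' : π ⁻¹' {x}} (Γ : Path e.1 e'.1) :
    endAt hπ (pushPath hπ.continuous e.2 e'.2 Γ) e = e' := by
  refine Subtype.ext ?_
  change liftAt hπ (pushPath hπ.continuous e.2 e'.2 Γ) e 1 = e'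
  rw [liftAt_pushPath]
  exact Γ.target

/-- The lift of a loop as a path. -/
noncomputable def liftPathAt (γ : Path x x) (e : π ⁻¹' {x}) {z : X} (hz : liftAt hπ γ e 1 = z) :
    Path e.1 z :=
  ⟨liftAt hπ γ e, liftAt_zero hπ γ e, hz⟩

lemma pushPath_liftPathAt (γ : Path x x) (e : π ⁻¹' {x}) {z : π ⁻¹' {x}}
    (hz : liftAt hπ γ e 1 = z) :
    pushPath hπ.continuous e.2 z.2 (liftPathAt hπ γ e hz) = γ := by
  ext t
  exact proj_liftAt hπ γ e t

/-- Lifts with common end points are homotopic by simple connectedness, and the homotopy projects.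
The converse is homotopy lifting. -/
theorem endAt_eq_iff_homotopic [SimplyConnectedSpace X] {γ η : Path x x} (e : π ⁻¹' {x}) :
    endAt hπ γ e = endAt hπ η e ↔ γ.Homotopic η := by
  constructor
  · intro h
    have h1 := SimplyConnectedSpace.paths_homotopic
      (liftPathAt hπ γ e (z := endAt hπ η e) (congrArg Subtype.val h)) (liftPathAt hπ η e rfl)
    have h2 := (h1.map ⟨π, hπ.continuous⟩).pathCast (x₂ := x) (x₃ := x)
      (show x = π e.1 from Eq.symm e.2) (show x = π (endAt hπ η e).1 from Eq.symm (endAt hπ η e).2)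
    have h3 := pushPath_liftPathAt hπ γ e (z := endAt hπ η e) (congrArg Subtype.val h)
    have h4 := pushPath_liftPathAt hπ η e (z := endAt hπ η e) rfl
    exact (congrArg₂ Path.Homotopic h3 h4).mp h2
  · intro h
    exact Subtype.ext (hπ.liftPath_apply_one_eq_of_homotopicRel h _ _ _)

theorem mem_pathComponent_iff_endAt [SimplyConnectedSpace X] {γ η : Path x x} (e : π ⁻¹' {x}) :
    γ ∈ pathComponent η ↔ endAt hπ γ e = endAt hπ η e :=
  mem_pathComponent_iff_homotopic.trans (endAt_eq_iff_homotopic hπ e).symm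

include hπ in
lemma isOpen_pathComponent_loop [SimplyConnectedSpace X] (η : Path x x) (e : π ⁻¹' {x}) :
    IsOpen (pathComponent η) := by
  have := discreteTopology_fibre hπ (x := x)
  convert! (isOpen_discrete {endAt hπ η e}).preimage (continuous_endAt hπ e) using 1
  ext γ
  exact mem_pathComponent_iff_endAt hπ e

end Lifts

/-! ### Deck transformations of the universal covering -/

section Deck

variable {X Y : Type*} [TopologicalSpace X] [TopologicalSpace Y] {π : X → Y}
  (hπ : IsCoveringMap π) {x : Y}

/-- The image of a point of the fibre under a deck transformation. -/
def deckMap (φ : deckGroup π) (e : π ⁻¹' {x}) : π ⁻¹' {x} := ⟨φ.1 e.1, (φ.2 e.1).trans e.2⟩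

omit [TopologicalSpace Y] in
lemma deckMap_one (e : π ⁻¹' {x}) : deckMap 1 e = e := rfl

omit [TopologicalSpace Y] in
lemma deckMap_mul (φ ψ : deckGroup π) (e : π ⁻¹' {x}) :
    deckMap (φ * ψ) e = deckMap φ (deckMap ψ e) := rfl

include hπ in
lemma deck_ext [PreconnectedSpace X] {φ ψ : deckGroup π} {e : X} (h : φ.1 e = ψ.1 e) : φ = ψ := by
  refine Subtype.ext (DFunLike.coe_injective ?_)
  exact hπ.eq_of_comp_eq φ.1.continuous ψ.1.continuous
    (funext fun z => (φ.2 z).trans (ψ.2 z).symm) e h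

lemma liftAt_deckMap (γ : Path x x) (φ : deckGroup π) (e : π ⁻¹' {x}) (t : I) :
    liftAt hπ γ (deckMap φ e) t = φ.1 (liftAt hπ γ e t) := by
  have h : (⟨fun t => φ.1 (liftAt hπ γ e t), by fun_prop⟩ : C(I, X)) =
      liftAt hπ γ (deckMap φ e) := by
    refine eq_liftAt hπ (fun t => (φ.2 _).trans (proj_liftAt hπ γ e t)) ?_
    change φ.1 (liftAt hπ γ e 0) = _
    rw [liftAt_zero]
    rfl
  rw [← h]
  rfl

lemma endAt_deckMap (γ : Path x x) (φ : deckGroup π) (e : π ⁻¹' {x}) :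
    endAt hπ γ (deckMap φ e) = deckMap φ (endAt hπ γ e) :=
  Subtype.ext (liftAt_deckMap hπ γ φ e 1)

variable [SimplyConnectedSpace X] [LocallyPathConnectedSpace X]

include hπ in
-- The lifting criterion, applied to `π` itself, gives maps over `π` in both directions. Uniqueness
-- of lifts makes them mutually inverse and the result unique.
theorem existsUnique_deck (e e' : π ⁻¹' {x}) : ∃! ψ : deckGroup π, ψ.1 e.1 = e'.1 := by
  have lift : ∀ a b : π ⁻¹' {x}, ∃ F : C(X, X), F a = b ∧ π ∘ F = π := fun a b =>
    (hπ.existsUnique_continuousMap_lifts ⟨π, hπ.continuous⟩ a.1 b.1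
      (Eq.trans b.2 (Eq.symm a.2))).exists
  have inv : ∀ (a b : π ⁻¹' {x}) (F G : C(X, X)), F a = b → G b = a → π ∘ F = π → π ∘ G = π →
      ∀ z, G (F z) = z := by
    intro a b F G hF hG hF' hG'
    refine congrFun (hπ.eq_of_comp_eq (g₁ := G ∘ F) (g₂ := id) (by fun_prop) continuous_id ?_ a.1
      (by simp [hF, hG]))
    rw [← Function.comp_assoc, hG', hF']
    rfl
  obtain ⟨F, hF, hF'⟩ := lift e e'
  obtain ⟨G, hG, hG'⟩ := lift e' e
  refine ⟨⟨⟨⟨F, G, inv e e' F G hF hG hF' hG', inv e' e G F hG hF hG' hF'⟩, F.continuous,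
    G.continuous⟩, congrFun hF'⟩, hF, fun ψ hψ => deck_ext hπ (e := e.1) ?_⟩
  exact hψ.trans hF.symm

/-- The deck transformation mapping `e` to `e'`. -/
noncomputable def deckOf (e e' : π ⁻¹' {x}) : deckGroup π := (existsUnique_deck hπ e e').choose

lemma deckMap_deckOf (e e' : π ⁻¹' {x}) : deckMap (deckOf hπ e e') e = e' :=
  Subtype.ext (existsUnique_deck hπ e e').choose_spec.1

omit [LocallyPathConnectedSpace X] in
include hπ in
lemma deckMap_injective {φ ψ : deckGroup π} {e : π ⁻¹' {x}} (h : deckMap φ e = deckMap ψ e) :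
    φ = ψ :=
  deck_ext hπ (congrArg Subtype.val h)

end Deck

/-! ### Components of the loop space and twisted loop spaces -/

section Components

variable {X Y : Type*} [TopologicalSpace X] [TopologicalSpace Y] {π : X → Y}
  (hπ : IsCoveringMap π) {x : Y} [SimplyConnectedSpace X]

lemma pushPath_mem_pathComponent {η : Path x x} {e : π ⁻¹' {x}} {φ : deckGroup π}
    (h : deckMap φ e = endAt hπ η e) (Γ : TwistedLoopSpace φ e.1) :
    pushPath hπ.continuous e.2 (deckMap φ e).2 Γ ∈ pathComponent η := by
  rw [mem_pathComponent_iff_endAt hπ e, ← h]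
  exact endAt_pushPath hπ (e' := deckMap φ e) Γ

/-- Lifting identifies a path component of the loop space with a twisted loop space. -/
noncomputable def liftHomeomorph (η : Path x x) (e : π ⁻¹' {x}) (φ : deckGroup π)
    (h : deckMap φ e = endAt hπ η e) : pathComponent η ≃ₜ TwistedLoopSpace φ e.1 where
  toFun γ := liftPathAt hπ γ.1 e
    (congrArg Subtype.val (((mem_pathComponent_iff_endAt hπ e).1 γ.2).trans h.symm))
  invFun Γ := ⟨pushPath hπ.continuous e.2 (deckMap φ e).2 Γ,
    pushPath_mem_pathComponent hπ h Γ⟩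
  left_inv γ := Subtype.ext (pushPath_liftPathAt hπ γ.1 e (z := deckMap φ e) _)
  right_inv Γ := by
    ext t
    exact congrArg (fun f : C(I, X) => f t) (liftAt_pushPath hπ (e' := deckMap φ e) Γ)
  continuous_toFun := continuous_path_iff.2 ((continuous_liftAt hπ e).comp continuous_subtype_val)
  continuous_invFun := (continuous_pushPath _ _ _).subtype_mk _

lemma liftHomeomorph_apply (η : Path x x) (e : π ⁻¹' {x}) (φ : deckGroup π)
    (h : deckMap φ e = endAt hπ η e) (γ : pathComponent η) (t : I) :
    liftHomeomorph hπ η e φ h γ t = liftAt hπ γ.1 e t := rfl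

/-- Taking `L` to be one lifting homeomorphism after the inverse of the other makes it a
homeomorphism for free. Its formula holds since `ψ` carries the lift at `e` to the lift at `ψ e`. -/
theorem exists_liftHomeomorphs (η : Path x x) (e e' : π ⁻¹' {x}) (φ ψ : deckGroup π)
    (hφ : φ.1 e.1 = liftAt hπ η e 1) (hψ : ψ.1 e.1 = e'.1) :
    ∃ (Ψ : pathComponent η ≃ₜ TwistedLoopSpace φ e.1)
      (Ψ' : pathComponent η ≃ₜ TwistedLoopSpace (ψ * φ * ψ⁻¹) e'.1)
      (L : TwistedLoopSpace φ e.1 ≃ₜ TwistedLoopSpace (ψ * φ * ψ⁻¹) e'.1),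
      (∀ γ t, Ψ γ t = liftAt hπ γ.1 e t) ∧ (∀ γ t, Ψ' γ t = liftAt hπ γ.1 e' t) ∧
      (∀ γ t, L γ t = ψ.1 (γ t)) ∧ ∀ γ, L (Ψ γ) = Ψ' γ := by
  obtain rfl : deckMap ψ e = e' := Subtype.ext hψ
  have h : deckMap φ e = endAt hπ η e := Subtype.ext hφ
  have h' : deckMap (ψ * φ * ψ⁻¹) (deckMap ψ e) = endAt hπ η (deckMap ψ e) := by
    rw [endAt_deckMap, ← h, ← deckMap_mul, inv_mul_cancel_right, deckMap_mul]
  refine ⟨liftHomeomorph hπ η e φ h, liftHomeomorph hπ η (deckMap ψ e) _ h',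
    (liftHomeomorph hπ η e φ h).symm.trans (liftHomeomorph hπ η (deckMap ψ e) _ h'),
    fun _ _ => rfl, fun _ _ => rfl, fun γ t => ?_, fun γ => by simp⟩
  obtain ⟨δ, rfl⟩ := (liftHomeomorph hπ η e φ h).surjective γ
  simp only [Homeomorph.trans_apply, Homeomorph.symm_apply_apply, liftHomeomorph_apply]
  exact liftAt_deckMap hπ δ.1 ψ e t

omit [SimplyConnectedSpace X] in
lemma liftAt_refl (e : π ⁻¹' {x}) (t : I) : liftAt hπ (Path.refl x) e t = e := by
  rw [← eq_liftAt hπ (γ := Path.refl x) (e := e) (Γ := .const I e.1) (fun _ => e.2) rfl]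
  rfl

theorem exists_liftHomeomorph_refl_iff (e : π ⁻¹' {x}) (φ : deckGroup π) :
    (∃ Ψ : pathComponent (Path.refl x) ≃ₜ TwistedLoopSpace φ e.1,
      ∀ γ t, Ψ γ t = liftAt hπ γ.1 e t) ↔ φ = 1 := by
  constructor
  · rintro ⟨Ψ, hΨ⟩
    -- The lift of the constant loop is constant, so its end point forces `φ` to fix `e`.
    have h := hΨ ⟨Path.refl x, mem_pathComponent_self _⟩ 1
    rw [Path.target, liftAt_refl] at h
    exact deck_ext hπ (e := e.1) h
  · rintro rfl
    exact ⟨liftHomeomorph hπ _ e 1 (Subtype.ext (liftAt_refl hπ e 1).symm), fun _ _ => rfl⟩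

end Components

/-! ### The fundamental group -/

section Fundamental

variable {X Y : Type*} [TopologicalSpace X] [TopologicalSpace Y] {π : X → Y}
  (hπ : IsCoveringMap π) {x : Y} [SimplyConnectedSpace X] [LocallyPathConnectedSpace X]

omit [SimplyConnectedSpace X] [LocallyPathConnectedSpace X] in
lemma monodromy_mk (γ : Path x x) (e : π ⁻¹' {x}) :
    hπ.monodromy (Path.Homotopic.Quotient.mk γ) e = endAt hπ γ e := rfl

/-- The isomorphism from the fundamental group to the deck transformation group. -/
noncomputable def deckEquiv (e : π ⁻¹' {x}) : (FundamentalGroup Y x)ᵐᵒᵖ ≃* deckGroup π :=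
  MulEquiv.ofBijective
    (MulHom.mk (fun a => deckOf hπ e (hπ.monodromy a.unop.toPath e)) fun a b => by
      obtain ⟨γ, hγ⟩ := Path.Homotopic.Quotient.mk_surjective a.unop.toPath
      obtain ⟨δ, hδ⟩ := Path.Homotopic.Quotient.mk_surjective b.unop.toPath
      refine deckMap_injective hπ (e := e) ?_
      -- In the opposite group `a * b` means `a` followed by `b`. Since deck transformations commute
      -- with lifting, applying the one of `a` to the end point of `b` lifts `b` from the end point
      -- of `a`.
      have h : hπ.monodromy (a * b).unop.toPath e =
          hπ.monodromy b.unop.toPath (hπ.monodromy a.unop.toPath e) :=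
        hπ.monodromy_trans_apply _ _ _
      rw [deckMap_mul, deckMap_deckOf, deckMap_deckOf, h, ← hγ, ← hδ]
      simp only [monodromy_mk]
      rw [← endAt_deckMap, deckMap_deckOf])
    (by
      constructor
      · intro a b h
        obtain ⟨γ, hγ⟩ := Path.Homotopic.Quotient.mk_surjective a.unop.toPath
        obtain ⟨δ, hδ⟩ := Path.Homotopic.Quotient.mk_surjective b.unop.toPath
        have h' := congrArg (fun φ => deckMap φ e) h
        simp only [MulHom.coe_mk, deckMap_deckOf] at h'
        rw [← hγ, ← hδ, monodromy_mk, monodromy_mk, endAt_eq_iff_homotopic] at h'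
        refine MulOpposite.unop_injective ?_
        change a.unop.toPath = b.unop.toPath
        rw [← hγ, ← hδ]
        exact Path.Homotopic.Quotient.eq.2 h'
      · intro φ
        -- The preimage of `φ` is the class of the projection of any path from `e` to `φ e`.
        refine ⟨.op (FundamentalGroup.fromPath (Path.Homotopic.Quotient.mk
          (pushPath hπ.continuous e.2 (deckMap φ e).2
            (PathConnectedSpace.somePath e.1 (deckMap φ e).1)))), ?_⟩
        refine deckMap_injective hπ (e := e) ?_
        change deckMap (deckOf hπ e (endAt hπ _ e)) e = _
        rw [deckMap_deckOf, endAt_pushPath])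

lemma deckMap_deckEquiv (e : π ⁻¹' {x}) (γ : Path x x) :
    deckMap (deckEquiv hπ e (.op (FundamentalGroup.fromPath (Path.Homotopic.Quotient.mk γ)))) e =
      endAt hπ γ e :=
  deckMap_deckOf hπ e _

theorem deckEquiv_conj (e e' : π ⁻¹' {x}) (ψ : deckGroup π) (h : deckMap ψ e = e') :
    (deckEquiv hπ e).trans (MulAut.conj ψ) = deckEquiv hπ e' := by
  subst h
  refine MulEquiv.ext fun a => deckMap_injective hπ (e := deckMap ψ e) ?_
  obtain ⟨γ, hγ⟩ := Path.Homotopic.Quotient.mk_surjective a.unop.toPath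
  obtain rfl : a = .op (FundamentalGroup.fromPath (Path.Homotopic.Quotient.mk γ)) := by
    rw [hγ]
    rfl
  rw [deckMap_deckEquiv, endAt_deckMap, ← deckMap_deckEquiv, MulEquiv.trans_apply,
    MulAut.conj_apply, ← deckMap_mul, inv_mul_cancel_right, deckMap_mul]

end Fundamental

/-! ### The covering of the loop space by twisted loop spaces -/

/-- The image is open, and its complement is open because an empty fibre forces empty fibres over an
evenly covered neighbourhood. This supplies the base point `e₀` of the fibre. -/
lemma surjective_of_isCoveringMap {X Y : Type*} [TopologicalSpace X]
    [TopologicalSpace Y] [Nonempty X] [PreconnectedSpace Y] {π : X → Y} (hπ : IsCoveringMap π) :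
    Function.Surjective π := by
  have hclosed : IsClosed (range π) := by
    rw [← isOpen_compl_iff, isOpen_iff_forall_mem_open]
    intro y hy
    obtain ⟨-, U, hyU, hU, -, H, -⟩ := hπ y
    have hempty : IsEmpty (π ⁻¹' {y}) := ⟨fun e => hy ⟨e.1, e.2⟩⟩
    refine ⟨U, ?_, hU, hyU⟩
    rintro _ hz ⟨w, rfl⟩
    exact hempty.elim (H ⟨w, hz⟩).2
  exact range_eq_univ.1
    (IsClopen.eq_univ ⟨hclosed, hπ.isOpenMap.isOpen_range⟩ (range_nonempty π))

/-- A global trivialization given by a continuous open bijection. -/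
noncomputable def globalTrivialization {E B F : Type*} [TopologicalSpace E] [TopologicalSpace B]
    [TopologicalSpace F] (p : E → B) (k : E → F)
    (hb : Function.Bijective fun z => (p z, k z)) (hc : Continuous fun z => (p z, k z))
    (ho : IsOpenMap fun z => (p z, k z)) : Bundle.Trivialization F p where
  toOpenPartialHomeomorph :=
    ((Equiv.ofBijective _ hb).toHomeomorphOfContinuousOpen hc ho).toOpenPartialHomeomorph
  baseSet := univ
  open_baseSet := isOpen_univ
  source_eq := rfl
  target_eq := univ_prod_univ.symm
  proj_toFun _ _ := rfl

lemma isOpenMap_prodMk_const {E B F : Type*} [TopologicalSpace E] [TopologicalSpace B]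
    [TopologicalSpace F] [DiscreteTopology F] {f : E → B} (hf : IsOpenMap f) (c : F) :
    IsOpenMap fun z => (f z, c) := by
  intro U hU
  convert! (hf U hU).prod (isOpen_discrete {c}) using 1
  ext ⟨b, d⟩
  simp only [mem_image, Prod.mk.injEq, mem_prod, mem_singleton_iff]
  constructor
  · rintro ⟨z, hz, rfl, rfl⟩
    exact ⟨⟨z, hz, rfl⟩, rfl⟩
  · rintro ⟨⟨z, hz, rfl⟩, rfl⟩
    exact ⟨z, hz, rfl, rfl⟩

section Total

variable {X Y : Type*} [TopologicalSpace X] [TopologicalSpace Y] {π : X → Y}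
  (hπ : IsCoveringMap π) {x : Y} [SimplyConnectedSpace X]

include hπ in
-- The index is redundant: the starting point gives `e`, and the end point then determines `φ`.
lemma totalSpace_ext {z w : TotalSpace π x} (h : ∀ t, z.2 t = w.2 t) : z = w := by
  obtain ⟨⟨φ, e⟩, γ⟩ := z
  obtain ⟨⟨ψ, e'⟩, δ⟩ := w
  have h0 := h 0
  have h1 := h 1
  simp only [Path.source, Path.target] at h0 h1
  obtain rfl : e = e' := Subtype.ext h0
  obtain rfl : φ = ψ := deck_ext hπ h1
  congr 1
  ext t
  exact h t

/-- On each summand the projection is the inverse of a lifting homeomorphism followed by the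
inclusion of an open component. -/
lemma isOpenMap_pushPath_twisted (φ : deckGroup π) (e : π ⁻¹' {x}) :
    IsOpenMap (fun γ : TwistedLoopSpace φ e.1 => totalProj hπ.continuous (x := x) ⟨(φ, e), γ⟩) := by
  set η : Path x x := pushPath hπ.continuous e.2 (deckMap φ e).2
    (PathConnectedSpace.somePath e.1 (deckMap φ e).1) with hη
  have h : deckMap φ e = endAt hπ η e := (endAt_pushPath hπ _).symm
  exact (isOpen_pathComponent_loop hπ η e).isOpenMap_subtype_val.comp
    (liftHomeomorph hπ η e φ h).symm.isOpenMap

omit [SimplyConnectedSpace X] in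
lemma continuous_totalProj : Continuous (totalProj hπ.continuous (x := x)) :=
  continuous_sigma fun p => continuous_pushPath hπ.continuous p.2.2 (deckMap p.1 p.2).2

omit [SimplyConnectedSpace X] in
lemma liftAt_totalProj (z : TotalSpace π x) :
    liftAt hπ (totalProj hπ.continuous z) z.1.2 = (z.2 : C(I, X)) :=
  liftAt_pushPath hπ (e' := deckMap z.1.1 z.1.2) z.2

omit [SimplyConnectedSpace X] [TopologicalSpace Y] in
lemma totalAct_apply (z : TotalSpace π x) (ξ : deckGroup π) (t : I) :
    (totalAct z ξ).2 t = ξ⁻¹.1 (z.2 t) := rfl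

omit [SimplyConnectedSpace X] in
lemma totalProj_totalAct (z : TotalSpace π x) (ξ : deckGroup π) :
    totalProj hπ.continuous (totalAct z ξ) = totalProj hπ.continuous z := by
  ext t
  exact ξ⁻¹.2 (z.2 t)

omit [SimplyConnectedSpace X] [TopologicalSpace Y] in
lemma continuous_totalAct :
    Continuous fun q : TotalSpace π x × deckGroup π => totalAct q.1 q.2 := by
  refine continuous_prod_of_discrete_right.2 fun ξ => continuous_sigma fun p => ?_
  let F : TwistedLoopSpace p.1 p.2.1 → TwistedLoopSpace (ξ⁻¹ * p.1 * ξ) (deckMap ξ⁻¹ p.2).1 :=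
    fun γ => (totalAct (⟨p, γ⟩ : TotalSpace π x) ξ).2
  have h : Continuous F := continuous_path_of_uncurry (f := F) ?_
  · exact Continuous.comp (g := Sigma.mk (β := fun p : deckGroup π × (π ⁻¹' {x}) =>
      TwistedLoopSpace p.1 p.2.1) (ξ⁻¹ * p.1 * ξ, deckMap ξ⁻¹ p.2)) continuous_sigmaMk h
  change Continuous fun q : TwistedLoopSpace p.1 p.2.1 × I => ξ⁻¹.1 (q.1 q.2)
  exact ξ⁻¹.1.continuous.comp (by fun_prop)

variable [LocallyPathConnectedSpace X]

/-- The fibre coordinate of the total space relative to the point `e₀` of the fibre. -/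
noncomputable def fibreCoord (e₀ : π ⁻¹' {x}) (z : TotalSpace π x) : deckGroup π :=
  (deckOf hπ e₀ z.1.2)⁻¹

/-- The action multiplies `deckOf` of the starting point by `ξ⁻¹` on the left. The inverse in
`fibreCoord` turns this into right multiplication by `ξ`. -/
lemma fibreCoord_totalAct (e₀ : π ⁻¹' {x}) (z : TotalSpace π x) (ξ : deckGroup π) :
    fibreCoord hπ e₀ (totalAct z ξ) = fibreCoord hπ e₀ z * ξ := by
  have h : deckOf hπ e₀ (totalAct z ξ).1.2 = ξ⁻¹ * deckOf hπ e₀ z.1.2 := by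
    refine deckMap_injective hπ (e := e₀) ?_
    rw [deckMap_deckOf, deckMap_mul, deckMap_deckOf]
    rfl
  simp only [fibreCoord, h, mul_inv_rev, inv_inv]

/-- The group coordinate fixes the starting point, and a path is the unique lift of its projection
from there. The preimage of `(γ, ξ)` is the lift of `γ` at `ξ⁻¹ e₀`. -/
lemma bijective_totalProj_fibreCoord (e₀ : π ⁻¹' {x}) :
    Function.Bijective fun z => (totalProj hπ.continuous z, fibreCoord hπ e₀ z) := by
  constructor
  · intro z w h
    obtain ⟨h1, h2⟩ := Prod.mk.inj h
    have he : z.1.2 = w.1.2 := by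
      rw [← deckMap_deckOf hπ e₀ z.1.2, ← deckMap_deckOf hπ e₀ w.1.2, inv_injective h2]
    refine totalSpace_ext hπ fun t => ?_
    have hz := congrArg (fun f : C(I, X) => f t) (liftAt_totalProj hπ z)
    have hw := congrArg (fun f : C(I, X) => f t) (liftAt_totalProj hπ w)
    refine hz.symm.trans (Eq.trans ?_ hw)
    rw [he, h1]
  · rintro ⟨γ, ξ⟩
    set e := deckMap ξ⁻¹ e₀ with he
    refine ⟨⟨(deckOf hπ e (endAt hπ γ e), e), liftPathAt hπ γ e
      (congrArg Subtype.val (deckMap_deckOf hπ e (endAt hπ γ e)).symm)⟩, Prod.ext ?_ ?_⟩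
    · ext t
      exact proj_liftAt hπ γ e t
    · change (deckOf hπ e₀ e)⁻¹ = ξ
      rw [inv_eq_iff_eq_inv]
      refine deckMap_injective hπ (e := e₀) ?_
      rw [deckMap_deckOf]

lemma continuous_fibreCoord (e₀ : π ⁻¹' {x}) : Continuous (fibreCoord hπ e₀) :=
  continuous_sigma fun p => continuous_const (y := (deckOf hπ e₀ p.2)⁻¹)

/-- The global trivialization of the total space defined by a point of the fibre. -/
noncomputable def totalTrivialization (e₀ : π ⁻¹' {x}) :
    Bundle.Trivialization (deckGroup π) (totalProj hπ.continuous (x := x)) :=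
  globalTrivialization _ (fibreCoord hπ e₀) (bijective_totalProj_fibreCoord hπ e₀)
    ((continuous_totalProj hπ).prodMk (continuous_fibreCoord hπ e₀))
    (isOpenMap_sigma.2 fun p =>
      isOpenMap_prodMk_const (isOpenMap_pushPath_twisted hπ p.1 p.2) (deckOf hπ e₀ p.2)⁻¹)

lemma isCoveringMap_of_globalTrivialization {E B F : Type*} [TopologicalSpace E]
    [TopologicalSpace B] [TopologicalSpace F] [DiscreteTopology F] {p : E → B}
    (t : Bundle.Trivialization F p) (ht : t.baseSet = univ) : IsCoveringMap p :=
  fun b => (IsEvenlyCovered.of_trivialization (t := t)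
    (by rw [ht]; trivial)).to_isEvenlyCovered_preimage

lemma isCoveringMap_totalProj (e₀ : π ⁻¹' {x}) :
    IsCoveringMap (totalProj hπ.continuous (x := x)) :=
  isCoveringMap_of_globalTrivialization (totalTrivialization hπ e₀) rfl

lemma nonempty_fibre_equiv (e₀ : π ⁻¹' {x}) (γ : Path x x) :
    Nonempty ((totalProj hπ.continuous (x := x)) ⁻¹' {γ} ≃ FundamentalGroup Y x) := by
  have h : Function.Bijective
      fun z : (totalProj hπ.continuous (x := x)) ⁻¹' {γ} => fibreCoord hπ e₀ z.1 := by
    constructor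
    · intro z w hzw
      refine Subtype.ext ((bijective_totalProj_fibreCoord hπ e₀).1 (Prod.ext ?_ hzw))
      exact Eq.trans z.2 (Eq.symm w.2)
    · intro ξ
      obtain ⟨z, hz⟩ := (bijective_totalProj_fibreCoord hπ e₀).2 (γ, ξ)
      obtain ⟨h1, h2⟩ := Prod.mk.inj hz
      exact ⟨⟨z, h1⟩, h2⟩
  exact ⟨(Equiv.ofBijective _ h).trans
    ((deckEquiv hπ e₀).symm.toEquiv.trans MulOpposite.opEquiv.symm)⟩

theorem isPrincipalBundle_totalProj (e₀ : π ⁻¹' {x}) :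
    IsPrincipalBundle (totalProj hπ.continuous (x := x)) totalAct where
  isTopologicalGroup := inferInstance
  act_one z := totalSpace_ext hπ fun _ => rfl
  act_mul z g h := totalSpace_ext hπ fun t => by
    simp only [totalAct_apply, mul_inv_rev]
    rfl
  proj_act := totalProj_totalAct hπ
  continuous_act := continuous_totalAct
  exists_trivialization γ := ⟨totalTrivialization hπ e₀, trivial,
    fun z _ g => fibreCoord_totalAct hπ e₀ z g⟩

omit [LocallyPathConnectedSpace X] in
theorem exists_trivial_component_covering (e₀ : π ⁻¹' {x}) :
    ∃ h : ∀ z : Σ e : π ⁻¹' {x}, TwistedLoopSpace (1 : deckGroup π) e.1,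
        totalProj hπ.continuous ⟨(1, z.1), z.2⟩ ∈ pathComponent (Path.refl x),
      IsCoveringMap (fun z => (⟨_, h z⟩ : pathComponent (Path.refl x))) ∧
      Function.Surjective (fun z => (⟨_, h z⟩ : pathComponent (Path.refl x))) := by
  have := discreteTopology_fibre hπ (x := x)
  have hend : ∀ e : π ⁻¹' {x}, deckMap 1 e = endAt hπ (Path.refl x) e :=
    fun e => Subtype.ext (liftAt_refl hπ e 1).symm
  have h : ∀ z : Σ e : π ⁻¹' {x}, TwistedLoopSpace (1 : deckGroup π) e.1,
      totalProj hπ.continuous ⟨(1, z.1), z.2⟩ ∈ pathComponent (Path.refl x) :=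
    fun z => pushPath_mem_pathComponent hπ (hend z.1) z.2
  let p := fun z : Σ e : π ⁻¹' {x}, TwistedLoopSpace (1 : deckGroup π) e.1 =>
    (⟨_, h z⟩ : pathComponent (Path.refl x))
  have hp : ∀ e γ, p ⟨e, γ⟩ = (liftHomeomorph hπ (Path.refl x) e 1 (hend e)).symm γ :=
    fun e γ => rfl
  -- Here the starting point itself is the fibre coordinate, so the covering is the trivial one with
  -- fibre `π ⁻¹' {x}`.
  have hb : Function.Bijective fun z => (p z, z.1) := by
    constructor
    · rintro ⟨e, γ⟩ ⟨e', δ⟩ hzw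
      obtain ⟨h1, h2⟩ := Prod.mk.inj hzw
      obtain rfl : e = e' := h2
      rw [hp, hp] at h1
      rw [(liftHomeomorph hπ (Path.refl x) e 1 (hend e)).symm.injective h1]
    · rintro ⟨γ, e⟩
      exact ⟨⟨e, liftHomeomorph hπ (Path.refl x) e 1 (hend e) γ⟩,
        Prod.ext ((hp _ _).trans (Homeomorph.symm_apply_apply _ γ)) rfl⟩
  have hc : Continuous fun z => (p z, z.1) :=
    continuous_sigma fun e => (Homeomorph.continuous
      (liftHomeomorph hπ (Path.refl x) e 1 (hend e)).symm).prodMk continuous_const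
  have ho : IsOpenMap fun z => (p z, z.1) := isOpenMap_sigma.2 fun e =>
    isOpenMap_prodMk_const (liftHomeomorph hπ (Path.refl x) e 1 (hend e)).symm.isOpenMap e
  refine ⟨h, isCoveringMap_of_globalTrivialization (globalTrivialization p (fun z => z.1) hb hc ho)
    rfl, fun γ => ?_⟩
  obtain ⟨z, hz⟩ := hb.2 (γ, e₀)
  exact ⟨z, (Prod.mk.inj hz).1⟩

end Total

/-! ### The smooth principal bundle -/

section SmoothBundle

variable {X Y : Type*} [TopologicalSpace X] [TopologicalSpace Y] {π : X → Y}
  (hπ : IsCoveringMap π) {x : Y} [SimplyConnectedSpace X] [LocallyPathConnectedSpace X]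

lemma contMDiff_of_continuous_discrete {E F H H' A B : Type*} [NormedAddCommGroup E]
    [NormedSpace ℝ E] [NormedAddCommGroup F] [NormedSpace ℝ F] [TopologicalSpace H]
    [TopologicalSpace H'] {J : ModelWithCorners ℝ E H} {J' : ModelWithCorners ℝ F H'}
    [TopologicalSpace A] [ChartedSpace H A] [TopologicalSpace B] [ChartedSpace H' B]
    [DiscreteTopology B] {f : A → B} (hf : Continuous f) : ContMDiff J J' ∞ f := fun a =>
  (contMDiff_const (c := f a)).contMDiffAt.congr_of_eventuallyEq
    (hf.continuousAt.eventually (by simp [nhds_discrete] : {f a} ∈ 𝓝 (f a)))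

omit [SimplyConnectedSpace X] [LocallyPathConnectedSpace X] [TopologicalSpace Y] in
lemma lieGroup_deckGroup : LieGroup 𝓘(ℝ, PUnit.{1}) ∞ (deckGroup π) :=
  have : IsManifold 𝓘(ℝ, PUnit.{1}) ∞ (deckGroup π) := IsManifold.of_discreteTopology _
  { contMDiff_mul := contMDiff_of_discreteTopology
    contMDiff_inv := contMDiff_of_discreteTopology }

theorem isSmoothPrincipalBundle_totalProj {E : Type*} [NormedAddCommGroup E] [NormedSpace ℝ E]
    [CompleteSpace E] [ChartedSpace E (Path x x)] [IsManifold 𝓘(ℝ, E) ∞ (Path x x)]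
    (e₀ : π ⁻¹' {x}) :
    let _ := pullbackChartedSpace (V := E) (isCoveringMap_totalProj hπ e₀).isLocalHomeomorph
    IsSmoothPrincipalBundle PUnit.{1} E E (totalProj hπ.continuous (x := x)) totalAct := by
  intro _
  have hloc : IsLocalDiffeomorph 𝓘(ℝ, E) 𝓘(ℝ, E) ∞ (totalProj hπ.continuous (x := x)) :=
    isLocalDiffeomorph_pullbackChartedSpace (isCoveringMap_totalProj hπ e₀).isLocalHomeomorph
  have htop := isPrincipalBundle_totalProj hπ e₀
  refine ⟨lieGroup_deckGroup, isManifold_pullbackChartedSpace _, inferInstance, htop.act_one,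
    htop.act_mul, htop.proj_act, hloc.contMDiff, ?_, fun γ => ⟨totalTrivialization hπ e₀, trivial,
      fun z _ g => fibreCoord_totalAct hπ e₀ z g, ?_, ?_⟩⟩
  -- Smoothness is tested after the local diffeomorphism `totalProj`, which forgets the group
  -- element. The inverse trivialisation below is treated in the same way.
  · refine contMDiff_of_comp_isLocalDiffeomorph hloc htop.continuous_act ?_
    simp only [htop.proj_act]
    exact hloc.contMDiff.comp contMDiff_fst
  · exact (hloc.contMDiff.prodMk
      (contMDiff_of_continuous_discrete (continuous_fibreCoord hπ e₀))).contMDiffOn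
  · set t := totalTrivialization hπ e₀ with ht
    have htt : t.target = univ := rfl
    have hc : Continuous t.toOpenPartialHomeomorph.symm := by
      rw [← continuousOn_univ, ← htt]
      exact t.toOpenPartialHomeomorph.continuousOn_symm
    have h : ContMDiff (𝓘(ℝ, E).prod 𝓘(ℝ, PUnit.{1})) 𝓘(ℝ, E) ∞
        t.toOpenPartialHomeomorph.symm := by
      refine contMDiff_of_comp_isLocalDiffeomorph hloc hc ?_
      have hp : ∀ q, totalProj hπ.continuous (t.toOpenPartialHomeomorph.symm q) = q.1 :=
        fun q => t.proj_symm_apply (by rw [htt]; trivial)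
      simp only [hp]
      exact contMDiff_fst
    exact h.contMDiffOn

end SmoothBundle

end TwistedLoops

open TwistedLoops in
theorem theoremA1 {M : Type*} {M' : Type*} [TopologicalSpace M] [TopologicalSpace M'] (n : ℕ)
    -- `M` is a connected topological manifold with base point `x`
    [T2Space M] [ParacompactSpace M] [ConnectedSpace M]
    (hM : Nonempty (ChartedSpace (EuclideanSpace ℝ (Fin n)) M)) (x : M)
    -- `π : M' → M` is its universal covering
    [SimplyConnectedSpace M'] (π : M' → M) (hπ : IsCoveringMap π) :
    -- given `e`, `e'` in the fibre, there is exactly one deck transformation mapping `e` to `e'`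
    (∀ e e' : π ⁻¹' {x}, ∃! ψ : deckGroup π, ψ.1 e.1 = e'.1) ∧
    -- the path components of the based loop space are the elements of the fundamental group
    (∀ η γ : Path x x, γ ∈ pathComponent η ↔ γ.Homotopic η) ∧
    -- (a)
    (∀ (η : Path x x) (e e' : π ⁻¹' {x}) (φ ψ : deckGroup π),
      φ.1 e.1 = liftAt hπ η e 1 → ψ.1 e.1 = e'.1 →
      ∃ (Ψ : pathComponent η ≃ₜ TwistedLoopSpace φ e.1)
        (Ψ' : pathComponent η ≃ₜ TwistedLoopSpace (ψ * φ * ψ⁻¹) e'.1)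
        (L : TwistedLoopSpace φ e.1 ≃ₜ TwistedLoopSpace (ψ * φ * ψ⁻¹) e'.1),
        (∀ γ t, Ψ γ t = liftAt hπ γ.1 e t) ∧ (∀ γ t, Ψ' γ t = liftAt hπ γ.1 e' t) ∧
        (∀ γ t, L γ t = ψ.1 (γ t)) ∧ ∀ γ, L (Ψ γ) = Ψ' γ) ∧
    (∀ (e : π ⁻¹' {x}) (φ : deckGroup π),
      (∃ Ψ : pathComponent (Path.refl x) ≃ₜ TwistedLoopSpace φ e.1,
        ∀ γ t, Ψ γ t = liftAt hπ γ.1 e t) ↔ φ = 1) ∧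
    -- (b); the product of Mathlib's fundamental group is the opposite of concatenation
    (∃ Φ : π ⁻¹' {x} → ((FundamentalGroup M x)ᵐᵒᵖ ≃* deckGroup π),
      (∀ (e : π ⁻¹' {x}) (γ : Path x x),
        (Φ e (.op (FundamentalGroup.fromPath (Path.Homotopic.Quotient.mk γ)))).1 e.1 =
          liftAt hπ γ e 1) ∧
      ∀ (e e' : π ⁻¹' {x}) (ψ : deckGroup π), ψ.1 e.1 = e'.1 →
        (Φ e).trans (MulAut.conj ψ) = Φ e') ∧
    -- (c)
    (IsCoveringMap (totalProj hπ.continuous (x := x)) ∧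
      ∀ γ : Path x x,
        Nonempty ((totalProj hπ.continuous (x := x)) ⁻¹' {γ} ≃ FundamentalGroup M x)) ∧
    (∃ h : ∀ z : Σ e : π ⁻¹' {x}, TwistedLoopSpace (1 : deckGroup π) e.1,
        totalProj hπ.continuous ⟨(1, z.1), z.2⟩ ∈ pathComponent (Path.refl x),
      IsCoveringMap (fun z => (⟨_, h z⟩ : pathComponent (Path.refl x))) ∧
      Function.Surjective (fun z => (⟨_, h z⟩ : pathComponent (Path.refl x)))) ∧
    IsPrincipalBundle (totalProj hπ.continuous (x := x)) totalAct ∧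
    -- for every smooth structure on `M`, with the lifted smooth structure on `M'`
    (∀ (_ : ChartedSpace (EuclideanSpace ℝ (Fin n)) M),
      IsManifold 𝓘(ℝ, EuclideanSpace ℝ (Fin n)) ∞ M →
      ∃ (_ : ChartedSpace (EuclideanSpace ℝ (Fin n)) M'),
        IsManifold 𝓘(ℝ, EuclideanSpace ℝ (Fin n)) ∞ M' ∧
        IsLocalDiffeomorph 𝓘(ℝ, EuclideanSpace ℝ (Fin n)) 𝓘(ℝ, EuclideanSpace ℝ (Fin n)) ∞ π ∧
        ∃ (_ : ChartedSpace (pathModel (EuclideanSpace ℝ (Fin n))) (Path x x))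
          (_ : ∀ (φ : deckGroup π) (e : π ⁻¹' {x}),
            ChartedSpace (pathModel (EuclideanSpace ℝ (Fin n))) (TwistedLoopSpace φ e.1))
          (_ : ChartedSpace (pathModel (EuclideanSpace ℝ (Fin n))) (TotalSpace π x)),
          IsStandardPathManifold (V := EuclideanSpace ℝ (Fin n)) x x ∧
          (∀ (φ : deckGroup π) (e : π ⁻¹' {x}),
            IsStandardPathManifold (V := EuclideanSpace ℝ (Fin n)) e.1 (φ.1 e.1) ∧
            IsLocalDiffeomorph 𝓘(ℝ, pathModel (EuclideanSpace ℝ (Fin n)))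
              𝓘(ℝ, pathModel (EuclideanSpace ℝ (Fin n))) ∞
              (fun γ : TwistedLoopSpace φ e.1 => (⟨(φ, e), γ⟩ : TotalSpace π x))) ∧
          IsSmoothPrincipalBundle PUnit.{1} (pathModel (EuclideanSpace ℝ (Fin n)))
            (pathModel (EuclideanSpace ℝ (Fin n)))
            (totalProj hπ.continuous (x := x)) totalAct) := by
  obtain ⟨_⟩ := hM
  -- The charts of `M` are pulled back only to obtain local path connectedness, which the lifting
  -- criterion needs.
  have _ : LocallyPathConnectedSpace M' :=
    let _ := pullbackChartedSpace (V := EuclideanSpace ℝ (Fin n)) hπ.isLocalHomeomorph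
    ChartedSpace.locallyPathConnectedSpace (EuclideanSpace ℝ (Fin n)) M'
  obtain ⟨w, hw⟩ := surjective_of_isCoveringMap hπ x
  let e₀ : π ⁻¹' {x} := ⟨w, hw⟩
  refine ⟨existsUnique_deck hπ, fun _ _ => mem_pathComponent_iff_homotopic,
    exists_liftHomeomorphs hπ, exists_liftHomeomorph_refl_iff hπ,
    ⟨deckEquiv hπ, fun e γ => congrArg Subtype.val (deckMap_deckEquiv hπ e γ),
      fun e e' ψ h => deckEquiv_conj hπ e e' ψ (Subtype.ext h)⟩,
    ⟨isCoveringMap_totalProj hπ e₀, nonempty_fibre_equiv hπ e₀⟩,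
    exists_trivial_component_covering hπ e₀, isPrincipalBundle_totalProj hπ e₀, ?_⟩
  intro _ _
  let _ := pullbackChartedSpace (V := EuclideanSpace ℝ (Fin n)) hπ.isLocalHomeomorph
  have hM' : IsManifold 𝓘(ℝ, EuclideanSpace ℝ (Fin n)) ∞ M' :=
    isManifold_pullbackChartedSpace hπ.isLocalHomeomorph
  have hloc : IsLocalDiffeomorph 𝓘(ℝ, EuclideanSpace ℝ (Fin n)) 𝓘(ℝ, EuclideanSpace ℝ (Fin n)) ∞ π :=
    isLocalDiffeomorph_pullbackChartedSpace hπ.isLocalHomeomorph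
  let _ : ChartedSpace (pathModel (EuclideanSpace ℝ (Fin n))) (Path x x) := pathChartedSpace x x
  let _ : ∀ (φ : deckGroup π) (e : π ⁻¹' {x}),
      ChartedSpace (pathModel (EuclideanSpace ℝ (Fin n))) (TwistedLoopSpace φ e.1) :=
    fun φ e => pathChartedSpace e.1 (φ.1 e.1)
  have hP : IsStandardPathManifold (V := EuclideanSpace ℝ (Fin n)) x x :=
    isStandardPathManifold_pathChartedSpace x x
  have _ := hP.isManifold
  let _ := pullbackChartedSpace (V := pathModel (EuclideanSpace ℝ (Fin n)))
    (isCoveringMap_totalProj hπ e₀).isLocalHomeomorph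
  refine ⟨inferInstance, hM', hloc, inferInstance, inferInstance, inferInstance, hP,
    fun φ e => ⟨isStandardPathManifold_pathChartedSpace e.1 (φ.1 e.1), ?_⟩,
    isSmoothPrincipalBundle_totalProj hπ e₀⟩
  have hι : Continuous fun γ : TwistedLoopSpace φ e.1 => (⟨(φ, e), γ⟩ : TotalSpace π x) :=
    Continuous.comp (g := Sigma.mk (β := fun p : deckGroup π × (π ⁻¹' {x}) =>
      TwistedLoopSpace p.1 p.2.1) (φ, e)) continuous_sigmaMk continuous_id
  -- The inclusion followed by `totalProj` is `pushPath` along `π`, so both the composite and the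
  -- outer map are local diffeomorphisms.
  exact isLocalDiffeomorph_of_comp hι
    (isLocalDiffeomorph_pullbackChartedSpace (isCoveringMap_totalProj hπ e₀).isLocalHomeomorph)
    (isLocalDiffeomorph_pushPath hloc hπ.continuous (y := e.1) (z := φ.1 e.1) e.2
      ((φ.2 e.1).trans e.2))
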